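/- Let $g$ be standard complex Gaussian if its real and imaginary parts are independent $N(0,1/2)$ variables. A Wishart matrix with parameters $(n,s)$ is a random matrix with the law of $GG^*$, where $G$ is an $n\times s$ matrix with i.i.d. standard complex Gaussian entries. Let $c>0$ and let $s=s(d)$ be natural numbers with $s(d)/d\to c$ as $d\to\infty$. On one probability space let, for every $d$, $W_1=W_1^{(d)}$ and $W_2=W_2^{(d)}$ be independent Wishart matrices with parameters $(d^2,s)$, regarded as operators on $\mathbb C^{d}\otimes\mathbb C^{d}$ (nothing is assumed about the joint law for different $d$). Put $$W=\frac1d\,\mathrm{Tr}_d\big[(W_1\otimes W_2)P_d\big],\qquad Z=d\,s\left(\frac{W}{d^2s^2}-\frac{\mathbf 1}{d^2}\right),$$ where $P_d=\sum_{i,j=1}^d|i\rangle\langle j|\otimes|i\rangle\langle j|$ acts on the first tensor factors $\mathbb C^d\otimes\mathbb C^d$ of the two copies of $\mathbb C^d\otimes\mathbb C^d$ (and as the identity on the second ones), and $\mathrm{Tr}_d$ is the partial trace over these two first factors, so that $W$ and $Z$ are $d^2\times d^2$ random matrices. Then for every integer $p\ge 0$ the random variable $\frac1{d^2}\mathrm{Tr}[Z^p]$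 is square integrable for every $d$, its variance is $O(1/d^2)$ as $d\to\infty$, and $$\frac1{d^2}\mathrm{Tr}[Z^p]-\mathbb E\Big(\frac1{d^2}\mathrm{Tr}[Z^p]\Big)\longrightarrow 0\quad\text{almost surely as } d\to\infty .$$ -/

import Mathlib

open MeasureTheory ProbabilityTheory Filter Topology Asymptotics
open scoped Kronecker

noncomputable section

namespace WishartSwap

/-- Matrices carry the entrywise (product) sigma-algebra. -/
instance matrixMeasurableSpace (m n : Type*) : MeasurableSpace (Matrix m n ℂ) :=
  inferInstanceAs (MeasurableSpace (m → n → ℂ))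

/-- The standard complex Gaussian distribution: the real and imaginary parts are independent
real Gaussians with mean `0` and variance `1 / 2`, so that `E |g|² = 1`. -/
def stdComplexGaussian : Measure ℂ :=
  ((gaussianReal 0 (1 / 2)).prod (gaussianReal 0 (1 / 2))).map
    Complex.measurableEquivRealProd.symm

/-- The law of an `m × n` random matrix with i.i.d. standard complex Gaussian entries. -/
def ginibre (m n : Type*) [Fintype m] [Fintype n] : Measure (Matrix m n ℂ) :=
  Measure.pi fun _ : m => Measure.pi fun _ : n => stdComplexGaussian

/-- The Wishart law with rows indexed by `m` and parameter `s`: the law of `G Gᴴ`, where `G` is an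
`m × s` random matrix with i.i.d. standard complex Gaussian entries. -/
def wishart (m : Type*) [Fintype m] (s : ℕ) : Measure (Matrix m m ℂ) :=
  (ginibre m (Fin s)).map fun G => G * G.conjTranspose

/-- The unnormalized Bell projection `∑ i j, |i⟩⟨j| ⊗ |i⟩⟨j|` on `ℂ^d ⊗ ℂ^d`. -/
def bell (d : ℕ) : Matrix (Fin d × Fin d) (Fin d × Fin d) ℂ :=
  ∑ i : Fin d, ∑ j : Fin d, Matrix.single i j (1 : ℂ) ⊗ₖ Matrix.single i j (1 : ℂ)

/-- The partial trace over the first tensor factor. -/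
def partialTrace {m n : Type*} [Fintype m] (T : Matrix (m × n) (m × n) ℂ) : Matrix n n ℂ :=
  Matrix.of fun a b => ∑ j : m, T (j, a) (j, b)

/-- The tensor product of two operators on `ℂ^d₁ ⊗ ℂ^d₂`, with the factors regrouped as
`(ℂ^d₁ ⊗ ℂ^d₁) ⊗ (ℂ^d₂ ⊗ ℂ^d₂)`. -/
def regroupedTensor {d₁ d₂ : ℕ} (A B : Matrix (Fin d₁ × Fin d₂) (Fin d₁ × Fin d₂) ℂ) :
    Matrix ((Fin d₁ × Fin d₁) × (Fin d₂ × Fin d₂)) ((Fin d₁ × Fin d₁) × (Fin d₂ × Fin d₂)) ℂ :=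
  (A ⊗ₖ B).reindex (Equiv.prodProdProdComm (Fin d₁) (Fin d₂) (Fin d₁) (Fin d₂))
    (Equiv.prodProdProdComm (Fin d₁) (Fin d₂) (Fin d₁) (Fin d₂))

/-- Entanglement swapping: `(1 / d₁) Tr_{d₁} [(A ⊗ B) P_{d₁}]`, where the Bell projection `P_{d₁}`
acts on the two parties of dimension `d₁`, and these two parties are traced out. -/
def swapping {d₁ d₂ : ℕ} (A B : Matrix (Fin d₁ × Fin d₂) (Fin d₁ × Fin d₂) ℂ) :
    Matrix (Fin d₂ × Fin d₂) (Fin d₂ × Fin d₂) ℂ :=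
  (1 / (d₁ : ℂ)) • partialTrace (regroupedTensor A B *
    (bell d₁ ⊗ₖ (1 : Matrix (Fin d₂ × Fin d₂) (Fin d₂ × Fin d₂) ℂ)))

/-- The rescaled matrix `Z = d₂ s (W / (d₂² s²) - 1 / d₂²)`, where `W` is obtained from `A` and `B`
by entanglement swapping. -/
def rescaled {d₁ d₂ : ℕ} (s : ℕ) (A B : Matrix (Fin d₁ × Fin d₂) (Fin d₁ × Fin d₂) ℂ) :
    Matrix (Fin d₂ × Fin d₂) (Fin d₂ × Fin d₂) ℂ :=
  ((d₂ : ℂ) * (s : ℂ)) •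
    ((1 / ((d₂ : ℂ) ^ 2 * (s : ℂ) ^ 2)) • swapping A B - (1 / (d₂ : ℂ) ^ 2) • 1)

/-- The normalized trace `(1 / d₂²) Tr [Z ^ p]`. -/
def normMoment {d₁ d₂ : ℕ} (s p : ℕ) (A B : Matrix (Fin d₁ × Fin d₂) (Fin d₁ × Fin d₂) ℂ) : ℂ :=
  (1 / (d₂ : ℂ) ^ 2) * (rescaled s A B ^ p).trace

end WishartSwap

end

noncomputable section

namespace WishartSwap

/-! ### Rotating a pair of vectors: size bounds and derivatives in the angle. -/

section Rotation

variable {E : Type*} [NormedAddCommGroup E] [NormedSpace ℝ E] {F : Type*} [NormedAddCommGroup F]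
  [NormedSpace ℝ F]

/-! Write the two Wishart matrices as `G * Gᴴ` and `H * Hᴴ`. Swapping turns them into a Gram matrix
again: `W = (1/d) K Kᴴ`, where the entries of `K = swapMat G H` are bilinear in `G` and `H`. Hence
`Z = a K Kᴴ - b` with `a = 1/(d² s)` of order `d⁻³` and `b = s/d` of order one, and `Tr Z^p` is a
polynomial in independent Gaussians.

Its variance is controlled by the Gaussian Poincaré inequality (`integral_sq_sub_mean_le`). By
cyclicity of the trace, the derivative of `Tr Z^(q+1)` in the direction `K'` is `2 (q+1) a Re Tr(Kᴴ
Z^q K')`. Averaging its square over Gaussian increments of `G` and `H` leaves at most a constant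
times `a² (‖G‖² + ‖H‖²) ‖Kᴴ Z^q‖²` in Frobenius norms (`integral_norm_fderiv_momentFn_sq_le`). The
expected orders are `d⁻⁶` for `a²`, `d³` for `‖G‖²`, and `d² · d³` for the last factor, provided
that `K Kᴴ` has spectral scale `d³`. So `Tr Z^p` has variance `O(d²)`, and division by `d²` turns
this into `O(1/d²)`.

The scale of `K Kᴴ` is the analytic core: `E Tr (K Kᴴ)^k = O(d^(3k+2))` for `k ≥ 1`. For fixed `H`
the matrix `K` is linear in `G`, so a noncommutative Khintchine inequality bounds its moments by
those of two explicit covariances, which are Gram matrices of rearrangements of `H`. A second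
application, to `H`, finishes (`integral_trace_swapMat_pow_le`). Khintchine itself follows from
Gaussian integration by parts and scalar inequalities for eigenvalues.

Almost sure convergence needs only the summability of `1/d²`, hence no relation between different
`d`. -/

theorem temperate_bound {f : E → F} (hf : f.HasTemperateGrowth) :
    ∃ (k : ℕ) (C : ℝ), 0 ≤ C ∧ ∀ x, ‖f x‖ ≤ C * (1 + ‖x‖) ^ k ∧
      ‖fderiv ℝ f x‖ ≤ C * (1 + ‖x‖) ^ k := by
  obtain ⟨k, C, hC, h⟩ := hf.norm_iteratedFDeriv_le_uniform 1
  refine ⟨k, C, hC, fun x => ⟨by simpa using h 0 (by simp) x, ?_⟩⟩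
  have := h 1 le_rfl x
  rwa [← norm_iteratedFDeriv_fderiv, norm_iteratedFDeriv_zero] at this

theorem norm_rotation_fst_le (θ : ℝ) (v : E × E) :
    ‖(ContinuousLinearMap.rotation θ v).1‖ ≤ 2 * ‖v‖ := by
  rw [ContinuousLinearMap.rotation_apply]
  calc _ ≤ ‖Real.cos θ • v.1‖ + ‖Real.sin θ • v.2‖ := norm_add_le _ _
    _ ≤ 1 * ‖v‖ + 1 * ‖v‖ := by
      rw [norm_smul, norm_smul]
      gcongr
      exacts [Real.abs_cos_le_one θ, norm_fst_le v, Real.abs_sin_le_one θ, norm_snd_le v]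
    _ = _ := by ring

theorem norm_rotation_snd_le (θ : ℝ) (v : E × E) :
    ‖(ContinuousLinearMap.rotation θ v).2‖ ≤ 2 * ‖v‖ := by
  rw [ContinuousLinearMap.rotation_apply]
  calc _ ≤ ‖-Real.sin θ • v.1‖ + ‖Real.cos θ • v.2‖ := norm_add_le _ _
    _ ≤ 1 * ‖v‖ + 1 * ‖v‖ := by
      rw [norm_smul, norm_smul, norm_neg]
      gcongr
      exacts [Real.abs_sin_le_one θ, norm_fst_le v, Real.abs_cos_le_one θ, norm_snd_le v]
    _ = _ := by ring

theorem hasDerivAt_rotation_fst (v : E × E) (θ : ℝ) :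
    HasDerivAt (fun t => (ContinuousLinearMap.rotation t v).1)
      (ContinuousLinearMap.rotation θ v).2 θ := by
  simp only [ContinuousLinearMap.rotation_apply]
  exact ((Real.hasDerivAt_cos θ).smul_const v.1).add ((Real.hasDerivAt_sin θ).smul_const v.2)

theorem hasDerivAt_rotation_snd (v : E × E) (θ : ℝ) :
    HasDerivAt (fun t => (ContinuousLinearMap.rotation t v).2)
      (-(ContinuousLinearMap.rotation θ v).1) θ := by
  simp only [ContinuousLinearMap.rotation_apply, neg_add, ← neg_smul]
  exact ((Real.hasDerivAt_sin θ).neg.smul_const v.1).add ((Real.hasDerivAt_cos θ).smul_const v.2)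

theorem continuous_rotation :
    Continuous fun q : ℝ × (E × E) => ContinuousLinearMap.rotation q.1 q.2 := by
  simp only [ContinuousLinearMap.rotation_apply]
  fun_prop

end Rotation

/-! ### Gaussian integration by parts and the Poincaré inequality, both from rotation invariance. -/

section GaussianAnalysis

variable {E : Type*} [NormedAddCommGroup E] [NormedSpace ℝ E] [MeasurableSpace E] [BorelSpace E]
  [SecondCountableTopology E] [CompleteSpace E] {F : Type*} [NormedAddCommGroup F]
  [NormedSpace ℝ F]

/-- Gaussian measures have finite moments of every order. The integrability of functions of
temperate growth below rests on this. -/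
theorem integrable_one_add_norm_pow (γ : Measure E) [IsGaussian γ] (k : ℕ) :
    Integrable (fun x => (1 + ‖x‖) ^ k) γ := by
  have h : MemLp (fun x : E => 1 + ‖x‖) k γ :=
    (memLp_const (1 : ℝ)).add (IsGaussian.memLp_id γ k (by simp)).norm
  refine h.integrable_norm_pow'.congr (ae_of_all _ fun x => ?_)
  have : 0 ≤ 1 + ‖x‖ := by positivity
  simp [Real.norm_of_nonneg this]

omit [NormedSpace ℝ F] in
theorem integrable_of_norm_le_pow {γ : Measure E} [IsGaussian γ] {f : E → F} {C : ℝ} {k : ℕ}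
    (hf : AEStronglyMeasurable f γ) (h : ∀ x, ‖f x‖ ≤ C * (1 + ‖x‖) ^ k) : Integrable f γ :=
  ((integrable_one_add_norm_pow γ k).const_mul C).mono' hf (ae_of_all _ h)

theorem integrable_of_temperate {γ : Measure E} [IsGaussian γ] {f : E → F}
    (hf : f.HasTemperateGrowth) : Integrable f γ := by
  obtain ⟨k, C, h⟩ := hf.2 0
  exact integrable_of_norm_le_pow (C := C) (k := k) hf.1.continuous.aestronglyMeasurable
    (fun x => by simpa using h x)

theorem memLp_two_of_temperate {γ : Measure E} [IsGaussian γ] {f : E → F}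
    (hf : f.HasTemperateGrowth) : MemLp f 2 γ := by
  rw [memLp_two_iff_integrable_sq_norm hf.1.continuous.aestronglyMeasurable]
  obtain ⟨k, C, h⟩ := hf.2 0
  refine integrable_of_norm_le_pow (C := C ^ 2) (k := k * 2)
    (hf.1.continuous.norm.pow 2).aestronglyMeasurable (fun x => ?_)
  have h' : ‖f x‖ ≤ C * (1 + ‖x‖) ^ k := by simpa using h x
  rw [Real.norm_of_nonneg (by positivity), pow_mul, ← mul_pow]
  gcongr

theorem integral_comp_rotation {γ : Measure E} [IsGaussian γ] (hγ : γ[id] = 0) (θ : ℝ)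
    {g : E × E → F} (hg : Continuous g) :
    ∫ v, g (ContinuousLinearMap.rotation θ v) ∂(γ.prod γ) = ∫ v, g v ∂(γ.prod γ) := by
  conv_rhs => rw [← IsGaussian.map_rotation_eq_self hγ θ]
  exact (integral_map_of_stronglyMeasurable (ContinuousLinearMap.continuous _).measurable
    hg.stronglyMeasurable).symm

/-- Gaussian integration by parts. -/
theorem integral_clm_mul {γ : Measure E} [IsGaussian γ] (hγ : γ[id] = 0) (l : E →L[ℝ] ℂ)
    {f : E → ℂ} (hf : f.HasTemperateGrowth) :
    ∫ x, l x * f x ∂γ = ∫ v, l v.2 * fderiv ℝ f v.1 v.2 ∂(γ.prod γ) := by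
  obtain ⟨k, C, hC, hb⟩ := temperate_bound hf
  have hfc : Continuous f := hf.1.continuous
  have hf' : Continuous (fderiv ℝ f) := hf.1.continuous_fderiv (by simp)
  have hfd : ∀ x, HasFDerivAt f (fderiv ℝ f x) x := fun x =>
    (hf.1.differentiable (by simp) x).hasFDerivAt
  -- By rotation invariance the integral of `h θ` does not depend on `θ`. Its derivative at `θ = 0`
  -- is the difference of the two sides of the claim.
  let h : ℝ → E × E → ℂ := fun θ v =>
    l (ContinuousLinearMap.rotation θ v).2 * f (ContinuousLinearMap.rotation θ v).1
  let h' : ℝ → E × E → ℂ := fun θ v =>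
    l (-(ContinuousLinearMap.rotation θ v).1) * f (ContinuousLinearMap.rotation θ v).1 +
    l (ContinuousLinearMap.rotation θ v).2 *
      fderiv ℝ f (ContinuousLinearMap.rotation θ v).1 (ContinuousLinearMap.rotation θ v).2
  have hder : ∀ θ v, HasDerivAt (fun t => h t v) (h' θ v) θ := fun θ v =>
    (l.hasFDerivAt.comp_hasDerivAt θ (hasDerivAt_rotation_snd v θ)).mul
      ((hfd _).comp_hasDerivAt θ (hasDerivAt_rotation_fst v θ))
  have hpow : ∀ (θ : ℝ) (v : E × E),
      (1 + ‖(ContinuousLinearMap.rotation θ v).1‖) ^ k ≤ 2 ^ k * (1 + ‖v‖) ^ k := fun θ v => by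
    rw [← mul_pow]
    gcongr
    linarith [norm_rotation_fst_le θ v, norm_nonneg v]
  -- A majorant uniform in `θ`, for differentiation under the integral; the 6 is 2 + 4 from the two
  -- summands of `h'`.
  have hbd : ∀ θ v, ‖h' θ v‖ ≤ (‖l‖ * C * 2 ^ k * 6) * (1 + ‖v‖) ^ (k + 2) := by
    intro θ v
    have h1 := norm_rotation_fst_le θ v
    have h2 := norm_rotation_snd_le θ v
    have hv := norm_nonneg v
    calc ‖h' θ v‖ ≤ (‖l‖ * (2 * ‖v‖)) * (C * (2 ^ k * (1 + ‖v‖) ^ k)) +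
        (‖l‖ * (2 * ‖v‖)) * ((C * (2 ^ k * (1 + ‖v‖) ^ k)) * (2 * ‖v‖)) := by
          refine (norm_add_le _ _).trans ?_
          rw [norm_mul, norm_mul]
          gcongr
          · exact (l.le_opNorm _).trans (by rw [norm_neg]; gcongr)
          · exact (hb _).1.trans (by gcongr; exact hpow θ v)
          · exact (l.le_opNorm _).trans (by gcongr)
          · refine (ContinuousLinearMap.le_opNorm _ _).trans ?_
            gcongr
            exact (hb _).2.trans (by gcongr; exact hpow θ v)
      _ = (‖l‖ * C * 2 ^ k) * (1 + ‖v‖) ^ k * (2 * ‖v‖ + 4 * ‖v‖ ^ 2) := by ring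
      _ ≤ (‖l‖ * C * 2 ^ k) * (1 + ‖v‖) ^ k * (6 * (1 + ‖v‖) ^ 2) := by
          gcongr
          nlinarith
      _ = _ := by ring
  have hmeas : ∀ θ, AEStronglyMeasurable (h θ) (γ.prod γ) := fun θ => by
    apply Continuous.aestronglyMeasurable
    fun_prop
  have hmeas' : ∀ θ, AEStronglyMeasurable (h' θ) (γ.prod γ) := fun θ => by
    apply Continuous.aestronglyMeasurable
    fun_prop
  have hint : Integrable (h 0) (γ.prod γ) := by
    refine integrable_of_norm_le_pow (C := ‖l‖ * C) (k := k + 1) (hmeas 0) fun v => ?_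
    simp only [h, ContinuousLinearMap.rotation_apply]
    simp only [Real.cos_zero, Real.sin_zero, one_smul, zero_smul, neg_zero, zero_add, add_zero]
    have h1 := norm_fst_le v
    have h2 := norm_snd_le v
    calc ‖l v.2 * f v.1‖ ≤ (‖l‖ * (1 + ‖v‖)) * (C * (1 + ‖v‖) ^ k) := by
          rw [norm_mul]
          gcongr
          · exact (l.le_opNorm _).trans (by gcongr; linarith)
          · exact (hb _).1.trans (by gcongr)
      _ = _ := by ring
  have key := (hasDerivAt_integral_of_dominated_loc_of_deriv_le (μ := γ.prod γ) (F := h) (F' := h')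
    (x₀ := (0 : ℝ)) (s := Set.univ) univ_mem (Eventually.of_forall hmeas) hint (hmeas' 0)
    (ae_of_all _ fun v θ _ => hbd θ v) ((integrable_one_add_norm_pow _ _).const_mul _)
    (ae_of_all _ fun v θ _ => hder θ v)).2
  have hconst : (fun θ => ∫ v, h θ v ∂(γ.prod γ)) = fun _ => ∫ v, h 0 v ∂(γ.prod γ) := by
    funext θ
    have hg : Continuous fun v : E × E => l v.2 * f v.1 := by fun_prop
    exact (integral_comp_rotation hγ θ hg).trans (integral_comp_rotation hγ 0 hg).symm
  rw [hconst] at key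
  have h0 := key.unique (hasDerivAt_const (0 : ℝ) _)
  have hsplit : ∀ v, h' 0 v = l v.2 * fderiv ℝ f v.1 v.2 - l v.1 * f v.1 := fun v => by
    simp only [h', ContinuousLinearMap.rotation_apply]
    simp only [Real.cos_zero, Real.sin_zero, one_smul, zero_smul, neg_zero, zero_add, add_zero,
      map_neg]
    ring
  have hi1 : Integrable (fun v : E × E => l v.1 * f v.1) (γ.prod γ) :=
    integrable_of_temperate (f := fun v : E × E => l v.1 * f v.1)
      ((l.comp (.fst ℝ E E)).hasTemperateGrowth.mul
        (hf.comp (ContinuousLinearMap.fst ℝ E E).hasTemperateGrowth))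
  have hi2 : Integrable (fun v : E × E => l v.2 * fderiv ℝ f v.1 v.2) (γ.prod γ) := by
    have := ((integrable_one_add_norm_pow (γ.prod γ) _).const_mul _).mono' (hmeas' 0)
      (ae_of_all _ (hbd 0))
    refine (this.add hi1).congr (ae_of_all _ fun v => ?_)
    simp only [Pi.add_apply, hsplit]
    ring
  simp only [hsplit] at h0
  rw [integral_sub hi2 hi1, sub_eq_zero] at h0
  rw [h0]
  rw [integral_fun_fst (μ := γ) (ν := γ) (fun x => l x * f x), probReal_univ, one_smul]

/-- Cauchy–Schwarz, obtained by expanding the nonnegative integral of `(‖g‖ - mean)²`. -/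
theorem sq_norm_intervalIntegral_le {a : ℝ} (ha : 0 ≤ a) {g : ℝ → ℂ} (hg : Continuous g) :
    ‖∫ t in (0)..a, g t‖ ^ 2 ≤ a * ∫ t in (0)..a, ‖g t‖ ^ 2 := by
  rcases ha.eq_or_lt with rfl | ha
  · simp
  set I := ∫ t in (0)..a, ‖g t‖ with hI
  have h1 : ‖∫ t in (0)..a, g t‖ ≤ I := intervalIntegral.norm_integral_le_integral_norm ha.le
  have h2 : 0 ≤ ∫ t in (0)..a, (‖g t‖ - I / a) ^ 2 :=
    intervalIntegral.integral_nonneg ha.le fun t _ => sq_nonneg _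
  have h3 : ∫ t in (0)..a, (‖g t‖ - I / a) ^ 2 =
      (∫ t in (0)..a, ‖g t‖ ^ 2) - 2 * (I / a) * I + (I / a) ^ 2 * a := by
    have : ∀ t, (‖g t‖ - I / a) ^ 2 = ‖g t‖ ^ 2 - 2 * (I / a) * ‖g t‖ + (I / a) ^ 2 := fun t => by
      ring
    simp only [this]
    rw [intervalIntegral.integral_add, intervalIntegral.integral_sub,
      intervalIntegral.integral_const_mul, intervalIntegral.integral_const]
    · rw [← hI]
      simp [mul_comm]
    all_goals exact Continuous.intervalIntegrable (by fun_prop) _ _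
  have h4 : (∫ t in (0)..a, ‖g t‖ ^ 2) - 2 * (I / a) * I + (I / a) ^ 2 * a =
      (∫ t in (0)..a, ‖g t‖ ^ 2) - I ^ 2 / a := by
    field_simp
    ring
  have h5 : I ^ 2 / a ≤ ∫ t in (0)..a, ‖g t‖ ^ 2 := by linarith
  calc ‖∫ t in (0)..a, g t‖ ^ 2 ≤ I ^ 2 := by gcongr
    _ ≤ _ := by rwa [div_le_iff₀' ha] at h5

/-- The Gaussian Poincaré inequality, in the form obtained from Pisier's rotation argument. -/
theorem integral_sq_sub_mean_le {γ : Measure E} [IsGaussian γ] (hγ : γ[id] = 0)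
    {f : E → ℂ} (hf : f.HasTemperateGrowth) :
    ∫ x, ‖f x - ∫ y, f y ∂γ‖ ^ 2 ∂γ ≤
      2 * ∫ v, ‖fderiv ℝ f v.1 v.2‖ ^ 2 ∂(γ.prod γ) := by
  obtain ⟨k, C, hC, hb⟩ := temperate_bound hf
  have hfc : Continuous f := hf.1.continuous
  have hf' : Continuous (fderiv ℝ f) := hf.1.continuous_fderiv (by simp)
  have hfd : ∀ x, HasFDerivAt f (fderiv ℝ f x) x := fun x =>
    (hf.1.differentiable (by simp) x).hasFDerivAt
  -- The quarter turn carries the first coordinate to the second, so `f v.2 - f v.1` is the integral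
  -- over `[0, π/2]` of the derivative of `f` along the rotation. At each angle the integrand has
  -- the law it has at angle 0.
  set a := Real.pi / 2 with ha
  have ha0 : 0 ≤ a := by positivity
  let D : ℝ × (E × E) → ℂ := fun q => fderiv ℝ f (ContinuousLinearMap.rotation q.1 q.2).1
    (ContinuousLinearMap.rotation q.1 q.2).2
  have hDc : Continuous D := by
    have := continuous_rotation (E := E)
    fun_prop
  have hDb : ∀ q, ‖D q‖ ^ 2 ≤ (C ^ 2 * 2 ^ (2 * k) * 4) * (1 + ‖q.2‖) ^ (2 * k + 2) := by
    rintro ⟨θ, v⟩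
    have h1 := norm_rotation_fst_le θ v
    have h2 := norm_rotation_snd_le θ v
    have hv := norm_nonneg v
    have : ‖D (θ, v)‖ ≤ (C * (2 ^ k * (1 + ‖v‖) ^ k)) * (2 * (1 + ‖v‖)) := by
      refine (ContinuousLinearMap.le_opNorm _ _).trans ?_
      gcongr
      · refine (hb _).2.trans ?_
        rw [← mul_pow]
        gcongr
        dsimp only
        linarith
      · dsimp only
        linarith
    calc ‖D (θ, v)‖ ^ 2 ≤ ((C * (2 ^ k * (1 + ‖v‖) ^ k)) * (2 * (1 + ‖v‖))) ^ 2 := by gcongr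
      _ = _ := by ring
  have hpt : ∀ v : E × E, ‖f v.2 - f v.1‖ ^ 2 ≤ a * ∫ t in (0)..a, ‖D (t, v)‖ ^ 2 := fun v => by
    have hcont : Continuous fun t : ℝ => D (t, v) := by fun_prop
    have hft := intervalIntegral.integral_eq_sub_of_hasDerivAt (a := 0) (b := a)
      (f := fun t => f (ContinuousLinearMap.rotation t v).1) (f' := fun t => D (t, v))
      (fun t _ => (hfd _).comp_hasDerivAt t (hasDerivAt_rotation_fst v t))
      (hcont.intervalIntegrable _ _)
    have he : f v.2 - f v.1 = ∫ t in (0)..a, D (t, v) := by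
      rw [hft]
      simp [ContinuousLinearMap.rotation_apply, ha]
    rw [he]
    exact sq_norm_intervalIntegral_le ha0 hcont
  have hf1 : (fun v : E × E => f v.1).HasTemperateGrowth :=
    hf.comp (ContinuousLinearMap.fst ℝ E E).hasTemperateGrowth
  have hf2 : (fun v : E × E => f v.2).HasTemperateGrowth :=
    hf.comp (ContinuousLinearMap.snd ℝ E E).hasTemperateGrowth
  have hint : Integrable (fun q : ℝ × (E × E) => ‖D q‖ ^ 2)
      ((volume.restrict (Set.Ioc 0 a)).prod (γ.prod γ)) := by
    have hg := ((integrable_one_add_norm_pow (γ.prod γ) (2 * k + 2)).const_mul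
      (C ^ 2 * 2 ^ (2 * k) * 4)).comp_snd (volume.restrict (Set.Ioc 0 a))
    refine hg.mono' (by fun_prop) (ae_of_all _ fun q => ?_)
    rw [Real.norm_of_nonneg (by positivity)]
    exact hDb q
  have hmain : ∫ v, ‖f v.2 - f v.1‖ ^ 2 ∂(γ.prod γ) ≤
      a ^ 2 * ∫ v, ‖fderiv ℝ f v.1 v.2‖ ^ 2 ∂(γ.prod γ) := by
    calc _ ≤ ∫ v, (a * ∫ t in (0)..a, ‖D (t, v)‖ ^ 2) ∂(γ.prod γ) := by
          refine integral_mono ?_ ?_ hpt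
          · exact (memLp_two_iff_integrable_sq_norm (by fun_prop)).1
              (memLp_two_of_temperate (hf2.sub hf1))
          · refine Integrable.const_mul ?_ a
            simp only [intervalIntegral.integral_of_le ha0]
            exact hint.integral_prod_right
      _ = a * ∫ t in Set.Ioc 0 a, ∫ v, ‖D (t, v)‖ ^ 2 ∂(γ.prod γ) := by
          rw [integral_const_mul]
          simp only [intervalIntegral.integral_of_le ha0]
          rw [integral_integral_swap (f := fun v t => ‖D (t, v)‖ ^ 2) hint.swap]
      _ = a * ∫ t in Set.Ioc 0 a, ∫ v, ‖fderiv ℝ f v.1 v.2‖ ^ 2 ∂(γ.prod γ) := by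
          congr 2
          funext t
          exact integral_comp_rotation hγ t
            (g := fun v : E × E => ‖fderiv ℝ f v.1 v.2‖ ^ 2) (by fun_prop)
      _ = _ := by
          simp [ha0]
          ring
  set m := ∫ y, f y ∂γ with hm
  have hfi : Integrable f γ := integrable_of_temperate hf
  have hgt : (fun x => f x - m).HasTemperateGrowth := by fun_prop
  have hg2 : Integrable (fun x => ‖f x - m‖ ^ 2) γ :=
    (memLp_two_iff_integrable_sq_norm (by fun_prop)).1 (memLp_two_of_temperate hgt)
  have hgi : Integrable (fun x => f x - m) γ := integrable_of_temperate hgt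
  have hg0 : ∫ x, (f x - m) ∂γ = 0 := by
    rw [integral_sub hfi (integrable_const _)]
    simp [hm]
  have hgc : Integrable (fun x => (starRingEnd ℂ) (f x - m)) γ :=
    (Complex.conjCLE : ℂ →L[ℝ] ℂ).integrable_comp hgi
  have hcross : Integrable (fun v : E × E => (f v.2 - m) * (starRingEnd ℂ) (f v.1 - m))
      (γ.prod γ) := by
    simpa only [mul_comm] using hgc.mul_prod hgi
  have hcross0 : ∫ v : E × E, (f v.2 - m) * (starRingEnd ℂ) (f v.1 - m) ∂(γ.prod γ) = 0 := by
    simp only [mul_comm (f _ - m)]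
    rw [integral_prod_mul (fun x => (starRingEnd ℂ) (f x - m)) (fun x => f x - m), hg0, mul_zero]
  have hexp : ∀ v : E × E, ‖f v.2 - f v.1‖ ^ 2 = ‖f v.1 - m‖ ^ 2 + ‖f v.2 - m‖ ^ 2 -
      2 * Complex.reCLM ((f v.2 - m) * (starRingEnd ℂ) (f v.1 - m)) := fun v => by
    have : f v.2 - f v.1 = (f v.2 - m) - (f v.1 - m) := by ring
    rw [this, Complex.sq_norm, Complex.normSq_sub, Complex.sq_norm, Complex.sq_norm]
    simp only [Complex.reCLM_apply]
    ring
  -- Two independent copies: the cross term factors into centred means and vanishes.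
  have hvar : ∫ v, ‖f v.2 - f v.1‖ ^ 2 ∂(γ.prod γ) = 2 * ∫ x, ‖f x - m‖ ^ 2 ∂γ := by
    simp only [hexp]
    rw [integral_sub, integral_add, integral_const_mul, ContinuousLinearMap.integral_comp_comm _
      hcross, hcross0, integral_fun_fst (fun x => ‖f x - m‖ ^ 2),
      integral_fun_snd (fun x => ‖f x - m‖ ^ 2)]
    · simp
      ring
    · exact hg2.comp_fst γ
    · exact hg2.comp_snd γ
    · exact (hg2.comp_fst γ).add (hg2.comp_snd γ)
    · exact (Complex.reCLM.integrable_comp hcross).const_mul 2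
  -- Twice the variance is at most `(π/2)²` times the energy; rounding `(π/2)²` up to 4 gives the
  -- constant 2.
  have hpi : a ^ 2 ≤ 4 := by
    have := Real.pi_le_four
    nlinarith
  have hnn : 0 ≤ ∫ v, ‖fderiv ℝ f v.1 v.2‖ ^ 2 ∂(γ.prod γ) := by positivity
  nlinarith

end GaussianAnalysis

/-! ### Trace inequalities reduced to scalar inequalities for eigenvalues. -/

section Spectral

open Matrix
open scoped ComplexOrder

variable {m n : Type*} [Fintype m] [Fintype n] [DecidableEq m] [DecidableEq n]

theorem exists_diagonalization {A : Matrix n n ℂ} (hA : A.IsHermitian) :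
    ∃ (U : Matrix n n ℂ) (l : n → ℝ), (A.PosSemidef → ∀ i, 0 ≤ l i) ∧ U * Uᴴ = 1 ∧ Uᴴ * U = 1 ∧
      ∀ q : ℕ, A ^ q = U * diagonal (fun i => ((l i ^ q : ℝ) : ℂ)) * Uᴴ := by
  refine ⟨hA.eigenvectorUnitary, hA.eigenvalues, fun h i => h.eigenvalues_nonneg i,
    Unitary.coe_mul_star_self hA.eigenvectorUnitary, Unitary.coe_star_mul_self hA.eigenvectorUnitary,
    fun q => ?_⟩
  conv_lhs => rw [hA.spectral_theorem, ← map_pow, diagonal_pow, Unitary.conjStarAlgAut_apply]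
  congr 3
  ext i
  simp

/-- Mixed traces of powers of two Hermitian matrices are weighted sums of products of powers of
their eigenvalues. -/
theorem exists_weights {A₁ : Matrix m m ℂ} {A₂ : Matrix n n ℂ} (h₁ : A₁.IsHermitian)
    (h₂ : A₂.IsHermitian) (B : Matrix m n ℂ) :
    ∃ (l₁ : m → ℝ) (l₂ : n → ℝ) (w : m → n → ℝ), (∀ u v, 0 ≤ w u v) ∧
      (A₁.PosSemidef → ∀ i, 0 ≤ l₁ i) ∧ (A₂.PosSemidef → ∀ i, 0 ≤ l₂ i) ∧
      ∀ q r : ℕ, trace (B * A₂ ^ q * Bᴴ * A₁ ^ r) =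
        ((∑ u, ∑ v, w u v * l₂ v ^ q * l₁ u ^ r : ℝ) : ℂ) := by
  obtain ⟨U₁, l₁, hp₁, -, -, hU₁⟩ := exists_diagonalization h₁
  obtain ⟨U₂, l₂, hp₂, -, -, hU₂⟩ := exists_diagonalization h₂
  -- `C` is `B` written in the two eigenbases. The weights `|C u v|²` do not depend on `q` and `r`,
  -- so a scalar inequality between monomials sums to a trace inequality.
  set C := U₁ᴴ * B * U₂ with hC
  refine ⟨l₁, l₂, fun u v => Complex.normSq (C u v), fun u v => Complex.normSq_nonneg _, hp₁, hp₂,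
    fun q r => ?_⟩
  have hCH : Cᴴ = U₂ᴴ * Bᴴ * U₁ := by
    simp [hC, conjTranspose_mul, Matrix.mul_assoc]
  have : trace (B * A₂ ^ q * Bᴴ * A₁ ^ r) =
      trace (C * diagonal (fun i => ((l₂ i ^ q : ℝ) : ℂ)) * Cᴴ *
        diagonal (fun i => ((l₁ i ^ r : ℝ) : ℂ))) := by
    rw [hU₁, hU₂, hCH, hC]
    simp only [← Matrix.mul_assoc]
    rw [trace_mul_comm _ U₁ᴴ]
    simp only [← Matrix.mul_assoc]
  rw [this, trace]
  push_cast
  refine Finset.sum_congr rfl fun u _ => ?_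
  rw [diag_apply, mul_diagonal, Matrix.mul_apply, Finset.sum_mul]
  refine Finset.sum_congr rfl fun v _ => ?_
  rw [mul_diagonal, conjTranspose_apply, Complex.normSq_eq_conj_mul_self]
  simp only [RCLike.star_def]
  ring

/-- Summed form of `a^q b^r ≤ a^(q+r) + b^(q+r)`, which holds for real `a`, `b` because `q + r` is
even. It brings the two copies of `B` together at the cost of a factor 2. -/
theorem trace_sandwich_le {A B : Matrix n n ℂ} (hA : A.IsHermitian) (hB : B.IsHermitian)
    {q r : ℕ} (hqr : Even (q + r)) :
    (trace (B * A ^ q * B * A ^ r)).re ≤ 2 * (trace (B * B * A ^ (q + r))).re := by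
  obtain ⟨l₁, l₂, w, hw, -, -, h⟩ := exists_weights hA hA B
  rw [hB.eq] at h
  -- The right side is split into two equal traces, with the whole power of `A` after or between the
  -- two `B`; they supply the two terms of the scalar bound.
  have e1 : trace (B * B * A ^ (q + r)) = trace (B * A ^ 0 * B * A ^ (q + r)) := by simp
  have e2 : trace (B * B * A ^ (q + r)) = trace (B * A ^ (q + r) * B * A ^ 0) := by
    rw [pow_zero, Matrix.mul_one, trace_mul_comm (B * A ^ (q + r)) B, Matrix.mul_assoc]
  rw [two_mul]
  nth_rewrite 2 [e1]
  rw [e2, h, h, h, Complex.ofReal_re, Complex.ofReal_re, Complex.ofReal_re, ← Finset.sum_add_distrib]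
  refine Finset.sum_le_sum fun u _ => ?_
  rw [← Finset.sum_add_distrib]
  refine Finset.sum_le_sum fun v _ => ?_
  have key : ∀ a b : ℝ, a ^ q * b ^ r ≤ a ^ (q + r) + b ^ (q + r) := fun a b => by
    have h1 : a ^ q * b ^ r ≤ |a| ^ q * |b| ^ r := by
      rw [← abs_pow, ← abs_pow, ← abs_mul]
      exact le_abs_self _
    rw [← hqr.pow_abs a, ← hqr.pow_abs b]
    refine h1.trans ?_
    rcases le_total |a| |b| with hab | hab
    · calc |a| ^ q * |b| ^ r ≤ |b| ^ q * |b| ^ r := by gcongr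
        _ = |b| ^ (q + r) := (pow_add _ _ _).symm
        _ ≤ _ := le_add_of_nonneg_left (by positivity)
    · calc |a| ^ q * |b| ^ r ≤ |a| ^ q * |a| ^ r := by gcongr
        _ = |a| ^ (q + r) := (pow_add _ _ _).symm
        _ ≤ _ := le_add_of_nonneg_right (by positivity)
  have := mul_le_mul_of_nonneg_left (key (l₂ v) (l₁ u)) (hw u v)
  simp only [pow_zero, mul_one]
  linarith

/-- A crude Young inequality: if `K a ≤ b/2` the first term suffices, otherwise `b ≤ 2 K a` and the
second does. The coefficient 1/2 is what permits absorption later. -/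
theorem mul_mul_pow_le {a b K : ℝ} (ha : 0 ≤ a) (hb : 0 ≤ b) (hK : 0 ≤ K) (n : ℕ) :
    K * (a * b ^ n) ≤ 1 / 2 * b ^ (n + 1) + (2 * K) ^ (n + 1) * a ^ (n + 1) := by
  rcases le_total (K * a) (b / 2) with h | h
  · have h1 : K * a * b ^ n ≤ b / 2 * b ^ n := by gcongr
    have h2 : 0 ≤ (2 * K) ^ (n + 1) * a ^ (n + 1) := by positivity
    rw [pow_succ b]
    linarith
  · have h1 : b ≤ 2 * K * a := by linarith
    have h2 : 0 ≤ 1 / 2 * b ^ (n + 1) := by positivity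
    have h3 : K * a * b ^ n ≤ (2 * K * a) * (2 * K * a) ^ n := by
      gcongr
      nlinarith [mul_nonneg hK ha]
    rw [← mul_pow, pow_succ (2 * K * a)]
    linarith

theorem trace_mul_pow_le {A S : Matrix n n ℂ} (hA : A.PosSemidef) (hS : S.PosSemidef) {K : ℝ}
    (hK : 0 ≤ K) (k : ℕ) :
    K * (trace (S * A ^ k)).re ≤
      1 / 2 * (trace (A ^ (k + 1))).re + (2 * K) ^ (k + 1) * (trace (S ^ (k + 1))).re := by
  obtain ⟨l₁, l₂, w, hw, hp₁, hp₂, h⟩ := exists_weights hA.1 hS.1 (1 : Matrix n n ℂ)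
  have hl₁ := hp₁ hA
  have hl₂ := hp₂ hS
  have e1 : trace (S * A ^ k) = trace (1 * S ^ 1 * (1 : Matrix n n ℂ)ᴴ * A ^ k) := by simp
  have e2 : trace (A ^ (k + 1)) = trace (1 * S ^ 0 * (1 : Matrix n n ℂ)ᴴ * A ^ (k + 1)) := by simp
  have e3 : trace (S ^ (k + 1)) = trace (1 * S ^ (k + 1) * (1 : Matrix n n ℂ)ᴴ * A ^ 0) := by simp
  rw [e1, e2, e3, h, h, h, Complex.ofReal_re, Complex.ofReal_re, Complex.ofReal_re]
  simp only [Finset.mul_sum, ← Finset.sum_add_distrib]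
  refine Finset.sum_le_sum fun u _ => Finset.sum_le_sum fun v _ => ?_
  have := mul_le_mul_of_nonneg_left (mul_mul_pow_le (hl₂ v) (hl₁ u) hK k) (hw u v)
  simp only [pow_zero, pow_one, mul_one]
  linarith

end Spectral

/-! ### Entrywise calculus of matrix-valued functions of temperate growth. -/

section TemperateMatrix

open Matrix

variable {E : Type*} [NormedAddCommGroup E] [NormedSpace ℝ E] {l m n : Type*}

/-- A matrix-valued function whose entries have temperate growth. -/
def TemperateMatrix (A : E → Matrix m n ℂ) : Prop :=
  ∀ i j, (fun x => A x i j).HasTemperateGrowth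

theorem TemperateMatrix.const (A : Matrix m n ℂ) : TemperateMatrix fun _ : E => A :=
  fun i j => .const (A i j)

theorem TemperateMatrix.mul [Fintype m] {A : E → Matrix l m ℂ} {B : E → Matrix m n ℂ}
    (hA : TemperateMatrix A) (hB : TemperateMatrix B) : TemperateMatrix fun x => A x * B x := by
  intro i j
  simp only [Matrix.mul_apply]
  exact .sum fun k _ => (hA i k).mul (hB k j)

theorem TemperateMatrix.sub {A B : E → Matrix m n ℂ} (hA : TemperateMatrix A)
    (hB : TemperateMatrix B) : TemperateMatrix fun x => A x - B x :=
  fun i j => (hA i j).sub (hB i j)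

theorem TemperateMatrix.const_smul (c : ℂ) {A : E → Matrix m n ℂ} (hA : TemperateMatrix A) :
    TemperateMatrix fun x => c • A x :=
  fun i j => (Function.HasTemperateGrowth.const c).mul (hA i j)

theorem TemperateMatrix.conjTranspose {A : E → Matrix m n ℂ} (hA : TemperateMatrix A) :
    TemperateMatrix fun x => (A x)ᴴ :=
  fun i j => (Complex.conjCLE : ℂ →L[ℝ] ℂ).hasTemperateGrowth.comp (hA j i)

theorem TemperateMatrix.pow [Fintype n] [DecidableEq n] {A : E → Matrix n n ℂ}
    (hA : TemperateMatrix A) (k : ℕ) : TemperateMatrix fun x => A x ^ k := by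
  induction k with
  | zero => simpa only [pow_zero] using TemperateMatrix.const 1
  | succ k ih => simpa only [pow_succ] using ih.mul hA

theorem TemperateMatrix.trace [Fintype n] {A : E → Matrix n n ℂ} (hA : TemperateMatrix A) :
    (fun x => (A x).trace).HasTemperateGrowth := by
  simp only [Matrix.trace, diag_apply]
  exact .sum fun i _ => hA i i

theorem TemperateMatrix.comp {F : Type*} [NormedAddCommGroup F] [NormedSpace ℝ F]
    {A : E → Matrix m n ℂ} (hA : TemperateMatrix A) (L : F →L[ℝ] E) :
    TemperateMatrix fun x => A (L x) :=
  fun i j => (hA i j).comp L.hasTemperateGrowth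

/-- The continuous linear functional given by an entry of a linear matrix-valued function. -/
def entryCLM [FiniteDimensional ℝ E] (X : E →ₗ[ℝ] Matrix m n ℂ) (i : m) (j : n) : E →L[ℝ] ℂ :=
  LinearMap.toContinuousLinearMap ((Matrix.entryLinearMap ℝ ℂ i j).comp X)

@[simp]
theorem entryCLM_apply [FiniteDimensional ℝ E] (X : E →ₗ[ℝ] Matrix m n ℂ) (i : m) (j : n) (x : E) :
    entryCLM X i j x = X x i j := rfl

theorem TemperateMatrix.linear [FiniteDimensional ℝ E] (X : E →ₗ[ℝ] Matrix m n ℂ) :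
    TemperateMatrix fun x => X x :=
  fun i j => (entryCLM X i j).hasTemperateGrowth

/-- Entrywise derivative of a curve of matrices. -/
def HasMatrixDerivAt (A : ℝ → Matrix m n ℂ) (A' : Matrix m n ℂ) (t : ℝ) : Prop :=
  ∀ i j, HasDerivAt (fun t => A t i j) (A' i j) t

theorem HasMatrixDerivAt.mul [Fintype m] {A : ℝ → Matrix l m ℂ} {A' : Matrix l m ℂ}
    {B : ℝ → Matrix m n ℂ} {B' : Matrix m n ℂ} {t : ℝ} (hA : HasMatrixDerivAt A A' t)
    (hB : HasMatrixDerivAt B B' t) :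
    HasMatrixDerivAt (fun t => A t * B t) (A' * B t + A t * B') t := by
  intro i j
  simp only [Matrix.mul_apply, Matrix.add_apply, ← Finset.sum_add_distrib]
  exact HasDerivAt.fun_sum fun k _ => (hA i k).mul (hB k j)

theorem HasMatrixDerivAt.const (A : Matrix m n ℂ) (t : ℝ) :
    HasMatrixDerivAt (fun _ => A) 0 t :=
  fun i j => hasDerivAt_const t (A i j)

theorem HasMatrixDerivAt.conjTranspose {A : ℝ → Matrix m n ℂ} {A' : Matrix m n ℂ} {t : ℝ}
    (hA : HasMatrixDerivAt A A' t) : HasMatrixDerivAt (fun t => (A t)ᴴ) A'ᴴ t :=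
  fun i j => (Complex.conjCLE : ℂ →L[ℝ] ℂ).hasFDerivAt.comp_hasDerivAt t (hA j i)

theorem HasMatrixDerivAt.const_smul {A : ℝ → Matrix m n ℂ} {A' : Matrix m n ℂ} {t : ℝ}
    (hA : HasMatrixDerivAt A A' t) (c : ℂ) : HasMatrixDerivAt (fun t => c • A t) (c • A') t :=
  fun i j => (hA i j).const_mul c

theorem HasMatrixDerivAt.sub_const {A : ℝ → Matrix m n ℂ} {A' : Matrix m n ℂ} {t : ℝ}
    (hA : HasMatrixDerivAt A A' t) (B : Matrix m n ℂ) : HasMatrixDerivAt (fun t => A t - B) A' t :=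
  fun i j => (hA i j).sub_const (B i j)

/-- Since `A'` need not commute with `A t`, the product rule leaves one term for each position of
`A'`. -/
theorem HasMatrixDerivAt.pow [Fintype n] [DecidableEq n] {A : ℝ → Matrix n n ℂ}
    {A' : Matrix n n ℂ} {t : ℝ} (hA : HasMatrixDerivAt A A' t) (k : ℕ) :
    HasMatrixDerivAt (fun t => A t ^ k)
      (∑ i ∈ Finset.range k, A t ^ i * A' * A t ^ (k - 1 - i)) t := by
  induction k with
  | zero => simpa using HasMatrixDerivAt.const (1 : Matrix n n ℂ) t
  | succ k ih =>
    have h := ih.mul hA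
    simp only [pow_succ]
    convert h using 1
    rw [Finset.sum_range_succ, Finset.sum_mul]
    congr 1
    · refine Finset.sum_congr rfl fun i hi => ?_
      have : k + 1 - 1 - i = (k - 1 - i) + 1 := by
        have := Finset.mem_range.1 hi
        omega
      rw [this, pow_succ, Matrix.mul_assoc, Matrix.mul_assoc, Matrix.mul_assoc]
    · simp

theorem HasMatrixDerivAt.trace [Fintype n] {A : ℝ → Matrix n n ℂ}
    {A' : Matrix n n ℂ} {t : ℝ} (hA : HasMatrixDerivAt A A' t) :
    HasDerivAt (fun t => (A t).trace) A'.trace t := by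
  simp only [Matrix.trace, diag_apply]
  exact HasDerivAt.fun_sum fun k _ => hA k k

theorem HasMatrixDerivAt.line (X : E →ₗ[ℝ] Matrix m n ℂ) (x y : E) :
    HasMatrixDerivAt (fun t => X (x + t • y)) (X y) 0 := by
  intro i j
  simp only [map_add, map_smul, Matrix.add_apply, Matrix.smul_apply]
  simpa using ((hasDerivAt_id (0 : ℝ)).smul_const (X y i j)).const_add (X x i j)

/-- Reduces Fréchet derivatives to curves on lines, where entrywise differentiation works and no
norm on matrices is needed. -/
theorem fderiv_apply_of_hasDerivAt_line {f : E → ℂ} (hf : f.HasTemperateGrowth) {x y : E} {c : ℂ}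
    (h : HasDerivAt (fun t : ℝ => f (x + t • y)) c 0) : fderiv ℝ f x y = c := by
  have h1 : HasFDerivAt f (fderiv ℝ f x) (x + (0 : ℝ) • y) := by
    simpa using (hf.1.differentiable (by simp) x).hasFDerivAt
  have h2 : HasDerivAt (fun t : ℝ => x + t • y) y 0 := by
    simpa using ((hasDerivAt_id (0 : ℝ)).smul_const y).const_add x
  exact (h1.comp_hasDerivAt 0 h2).unique h

end TemperateMatrix

/-! ### The noncommutative Khintchine inequality. -/

section Khintchine

open Matrix
open scoped ComplexOrder

variable {E : Type*} [NormedAddCommGroup E] [NormedSpace ℝ E] [MeasurableSpace E] [BorelSpace E]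
  [SecondCountableTopology E] [CompleteSpace E] {m n : Type*}

/-- The entrywise expectation of a random matrix. -/
def matrixMean (γ : Measure E) (A : E → Matrix m n ℂ) : Matrix m n ℂ :=
  Matrix.of fun i j => ∫ x, A x i j ∂γ

theorem integrable_trace [Fintype n] {γ : Measure E} [IsGaussian γ] {A : E → Matrix n n ℂ}
    (hA : TemperateMatrix A) : Integrable (fun x => (A x).trace) γ :=
  integrable_of_temperate hA.trace

theorem integrable_trace_re [Fintype n] {γ : Measure E} [IsGaussian γ] {A : E → Matrix n n ℂ}
    (hA : TemperateMatrix A) : Integrable (fun x => (A x).trace.re) γ :=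
  (integrable_trace hA).re

theorem integral_trace_re [Fintype n] {γ : Measure E} [IsGaussian γ] {A : E → Matrix n n ℂ}
    (hA : TemperateMatrix A) : ∫ x, (A x).trace.re ∂γ = (∫ x, (A x).trace ∂γ).re :=
  Complex.reCLM.integral_comp_comm (integrable_trace hA)

theorem integral_trace [Fintype n] {γ : Measure E} [IsGaussian γ] {A : E → Matrix n n ℂ}
    (hA : TemperateMatrix A) : ∫ x, (A x).trace ∂γ = (matrixMean γ A).trace := by
  simp only [Matrix.trace, diag_apply, matrixMean, Matrix.of_apply]
  exact integral_finsetSum _ fun i _ => integrable_of_temperate (hA i i)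

theorem matrixMean_const_mul {l : Type*} [Fintype m] {γ : Measure E} [IsGaussian γ]
    (S : Matrix l m ℂ) {A : E → Matrix m n ℂ} (hA : TemperateMatrix A) :
    matrixMean γ (fun x => S * A x) = S * matrixMean γ A := by
  ext i j
  simp only [matrixMean, Matrix.of_apply, Matrix.mul_apply]
  rw [integral_finsetSum _ fun k _ => (integrable_of_temperate (hA k j)).const_mul _]
  simp only [integral_const_mul]

/-- Independent random matrices have multiplicative expectation. -/
theorem matrixMean_prod_mul {l : Type*} [Fintype m] {γ : Measure E} [IsGaussian γ]
    {A : E → Matrix l m ℂ} {B : E → Matrix m n ℂ} (hA : TemperateMatrix A)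
    (hB : TemperateMatrix B) :
    matrixMean (γ.prod γ) (fun v => A v.2 * B v.1) = matrixMean γ A * matrixMean γ B := by
  ext i j
  simp only [matrixMean, Matrix.of_apply, Matrix.mul_apply]
  rw [integral_finsetSum _ fun k _ => ?_]
  · refine Finset.sum_congr rfl fun k _ => ?_
    simp only [mul_comm (A _ i k)]
    rw [integral_prod_mul (fun x => B x k j) (fun x => A x i k), mul_comm]
  · exact integrable_of_temperate (((hA.comp (.snd ℝ E E)) i k).mul ((hB.comp (.fst ℝ E E)) k j))

/-- The quadratic form of the mean is the mean of the quadratic forms. -/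
theorem posSemidef_matrixMean [Fintype n] {γ : Measure E} [IsGaussian γ] {A : E → Matrix n n ℂ}
    (hA : TemperateMatrix A) (hp : ∀ x, (A x).PosSemidef) : (matrixMean γ A).PosSemidef := by
  refine PosSemidef.of_dotProduct_mulVec_nonneg ?_ fun v => ?_
  · ext i j
    simp only [matrixMean, conjTranspose_apply, Matrix.of_apply, RCLike.star_def]
    rw [← integral_conj]
    congr 1
    funext x
    exact (hp x).1.apply i j
  · have : star v ⬝ᵥ (matrixMean γ A *ᵥ v) = ∫ x, star v ⬝ᵥ (A x *ᵥ v) ∂γ := by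
      simp only [dotProduct, mulVec, matrixMean, Matrix.of_apply]
      rw [integral_finsetSum]
      · refine Finset.sum_congr rfl fun i _ => ?_
        rw [integral_const_mul, integral_finsetSum]
        · simp only [integral_mul_const]
        · exact fun j _ => (integrable_of_temperate (hA i j)).mul_const _
      · exact fun i _ => (integrable_finsetSum _ fun j _ =>
          (integrable_of_temperate (hA i j)).mul_const _).const_mul _
    rw [this]
    have h : (fun x => star v ⬝ᵥ (A x *ᵥ v)) =
        fun x => (((star v ⬝ᵥ (A x *ᵥ v)).re : ℝ) : ℂ) := by
      funext x
      exact Complex.eq_re_of_ofReal_le (r := 0) (by exact_mod_cast (hp x).dotProduct_mulVec_nonneg v)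
    rw [h, integral_complex_ofReal, Complex.zero_le_real]
    exact integral_nonneg fun x => (Complex.le_def.1 ((hp x).dotProduct_mulVec_nonneg v)).1

variable [FiniteDimensional ℝ E] [Fintype m] [Fintype n] [DecidableEq m] [DecidableEq n]

/-- Gaussian integration by parts for moments of a linear Gaussian random matrix. -/
theorem integral_trace_pow_succ {γ : Measure E} [IsGaussian γ] (hγ : γ[id] = 0)
    (X : E →ₗ[ℝ] Matrix n n ℂ) (k : ℕ) :
    ∫ x, (X x ^ (k + 1)).trace ∂γ = ∑ i ∈ Finset.range k,
      ∫ v, (X v.2 * X v.1 ^ i * X v.2 * X v.1 ^ (k - 1 - i)).trace ∂(γ.prod γ) := by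
  have hX := TemperateMatrix.linear X
  have hX1 : TemperateMatrix fun v : E × E => X v.1 := hX.comp (.fst ℝ E E)
  have hX2 : TemperateMatrix fun v : E × E => X v.2 := hX.comp (.snd ℝ E E)
  have hder : ∀ (v : E × E) (i j : n), fderiv ℝ (fun x => (X x ^ k) i j) v.1 v.2 =
      (∑ i ∈ Finset.range k, X v.1 ^ i * X v.2 * X v.1 ^ (k - 1 - i)) i j := fun v i j => by
    refine fderiv_apply_of_hasDerivAt_line (hX.pow k i j) ?_
    have := (HasMatrixDerivAt.line X v.1 v.2).pow k i j
    simpa using this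
  -- Expand `Tr X^(k+1)` as the sum of `X i j * (X^k) j i` and integrate by parts against the linear
  -- functional `X i j`.
  calc ∫ x, (X x ^ (k + 1)).trace ∂γ
      = ∑ i, ∑ j, ∫ x, X x i j * (X x ^ k) j i ∂γ := by
        simp only [pow_succ' (X _) k, Matrix.trace, diag_apply, Matrix.mul_apply]
        rw [integral_finsetSum _ fun i _ => integrable_finsetSum _ fun j _ =>
          integrable_of_temperate ((hX i j).fun_mul (hX.pow k j i))]
        refine Finset.sum_congr rfl fun i _ => ?_
        rw [integral_finsetSum _ fun j _ =>
          integrable_of_temperate ((hX i j).fun_mul (hX.pow k j i))]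
    _ = ∑ i, ∑ j, ∫ v, X v.2 i j *
          (∑ i ∈ Finset.range k, X v.1 ^ i * X v.2 * X v.1 ^ (k - 1 - i)) j i ∂(γ.prod γ) := by
        refine Finset.sum_congr rfl fun i _ => Finset.sum_congr rfl fun j _ => ?_
        simpa only [hder, entryCLM_apply] using
          integral_clm_mul hγ (entryCLM X i j) (hX.pow k j i)
    _ = ∑ i, ∑ j, ∑ q ∈ Finset.range k, ∫ v, X v.2 i j *
          (X v.1 ^ q * X v.2 * X v.1 ^ (k - 1 - q)) j i ∂(γ.prod γ) := by
        refine Finset.sum_congr rfl fun i _ => Finset.sum_congr rfl fun j _ => ?_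
        simp only [Matrix.sum_apply, Finset.mul_sum]
        exact integral_finsetSum _ fun q _ => integrable_of_temperate
          ((hX2 i j).fun_mul ((((hX1.pow q).mul hX2).mul (hX1.pow _)) j i))
    _ = _ := by
        simp only [Finset.sum_comm (s := Finset.univ (α := n)) (t := Finset.range k)]
        refine Finset.sum_congr rfl fun q _ => ?_
        have : ∀ v : E × E, (X v.2 * X v.1 ^ q * X v.2 * X v.1 ^ (k - 1 - q)).trace =
            ∑ i, ∑ j, X v.2 i j * (X v.1 ^ q * X v.2 * X v.1 ^ (k - 1 - q)) j i := fun v => by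
          rw [Matrix.mul_assoc (X v.2), Matrix.mul_assoc (X v.2)]
          simp only [Matrix.trace, diag_apply]
          exact Finset.sum_congr rfl fun i _ => Matrix.mul_apply
        simp only [this]
        rw [integral_finsetSum]
        · refine Finset.sum_congr rfl fun i _ => (integral_finsetSum _ fun j _ => ?_).symm
          exact integrable_of_temperate
            ((hX2 i j).fun_mul ((((hX1.pow q).mul hX2).mul (hX1.pow _)) j i))
        · exact fun i _ => integrable_finsetSum _ fun j _ => integrable_of_temperate
            ((hX2 i j).fun_mul ((((hX1.pow q).mul hX2).mul (hX1.pow _)) j i))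

/-- The noncommutative Khintchine inequality for Hermitian Gaussian random matrices. -/
theorem integral_trace_pow_le {γ : Measure E} [IsGaussian γ] (hγ : γ[id] = 0)
    (X : E →ₗ[ℝ] Matrix n n ℂ) (hX : ∀ x, (X x).IsHermitian) (k : ℕ) :
    ∫ x, (X x ^ (2 * k)).trace.re ∂γ ≤
      2 * (8 * (k : ℝ)) ^ k * (matrixMean γ (fun x => X x * X x) ^ k).trace.re := by
  have hT := TemperateMatrix.linear X
  -- Integration by parts needs a factor to remove, so the zeroth moment is treated apart.
  rcases k with _ | k
  · simp
    linarith [(Nat.cast_nonneg (Fintype.card n) : (0 : ℝ) ≤ _)]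
  set S := matrixMean γ (fun x => X x * X x) with hS
  have hpsd : ∀ x, (X x * X x).PosSemidef := fun x => by
    have := posSemidef_self_mul_conjTranspose (X x)
    rwa [(hX x).eq] at this
  have hSp : S.PosSemidef := posSemidef_matrixMean (hT.mul hT) hpsd
  have hT1 : TemperateMatrix fun v : E × E => X v.1 := hT.comp (.fst ℝ E E)
  have hT2 : TemperateMatrix fun v : E × E => X v.2 := hT.comp (.snd ℝ E E)
  -- Each term `Tr(Y X^i Y X^(2k-i))`, with `Y` an independent copy of `X`, is at most `2 Tr(Y²
  -- X^(2k))` after integration; independence then replaces `Y²` by `S`.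
  have h1 : ∫ x, (X x ^ (2 * (k + 1))).trace.re ∂γ ≤
      ∑ i ∈ Finset.range (2 * k + 1), 2 * (S * matrixMean γ (fun x => X x ^ (2 * k))).trace.re := by
    rw [integral_trace_re (hT.pow _), show 2 * (k + 1) = (2 * k + 1) + 1 by ring,
      integral_trace_pow_succ hγ X, Complex.re_sum]
    refine Finset.sum_le_sum fun i hi => ?_
    have hik : i + (2 * k - i) = 2 * k := by
      have := Finset.mem_range.1 hi
      omega
    have e : 2 * k + 1 - 1 - i = 2 * k - i := by omega
    rw [e, ← integral_trace_re (((hT2.mul (hT1.pow i)).mul hT2).mul (hT1.pow _)),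
      hS, ← matrixMean_prod_mul (hT.mul hT) (hT.pow _), ← integral_trace
        (A := fun v : E × E => X v.2 * X v.2 * X v.1 ^ (2 * k)) ((hT2.mul hT2).mul (hT1.pow _)),
      ← integral_trace_re ((hT2.mul hT2).mul (hT1.pow _)), ← integral_const_mul]
    refine integral_mono (integrable_trace_re (((hT2.mul (hT1.pow i)).mul hT2).mul (hT1.pow _)))
      ((integrable_trace_re ((hT2.mul hT2).mul (hT1.pow _))).const_mul _) fun v => ?_
    have := trace_sandwich_le (hX v.1) (hX v.2) (q := i) (r := 2 * k - i)
      (by rw [hik]; exact even_two_mul k)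
    rwa [hik] at this
  rw [Finset.sum_const, Finset.card_range, nsmul_eq_mul] at h1
  -- There are `2k + 1` terms with factor 2 each, and `2 (2k + 1) ≤ 4 (k + 1)`. Enlarging the factor
  -- requires the trace to be nonnegative, which is `h3`.
  set K : ℝ := 4 * ((k : ℝ) + 1) with hK
  have h2 : K * (S * matrixMean γ (fun x => X x ^ (2 * k))).trace.re ≤
      1 / 2 * (∫ x, (X x ^ (2 * (k + 1))).trace.re ∂γ) +
        (2 * K) ^ (k + 1) * (S ^ (k + 1)).trace.re := by
    rw [← matrixMean_const_mul S (hT.pow _), ← integral_trace ((TemperateMatrix.const S).mul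
      (hT.pow _)), ← integral_trace_re ((TemperateMatrix.const S).mul (hT.pow _)),
      ← integral_const_mul]
    have : (2 * K) ^ (k + 1) * (S ^ (k + 1)).trace.re =
        ∫ _, (2 * K) ^ (k + 1) * (S ^ (k + 1)).trace.re ∂γ := by simp
    rw [this, ← integral_const_mul, ← integral_add ((integrable_trace_re (hT.pow _)).const_mul _)
      (integrable_const _)]
    refine integral_mono ((integrable_trace_re ((TemperateMatrix.const S).mul
      (hT.pow _))).const_mul _) (((integrable_trace_re (hT.pow _)).const_mul _).add
      (integrable_const _)) fun x => ?_
    have := trace_mul_pow_le (hpsd x) hSp (K := K) (by positivity) k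
    rwa [← pow_two, ← pow_mul, ← pow_mul] at this
  have h3 : 0 ≤ (S * matrixMean γ (fun x => X x ^ (2 * k))).trace.re := by
    rw [← matrixMean_const_mul S (hT.pow _), ← integral_trace ((TemperateMatrix.const S).mul
      (hT.pow _)), ← integral_trace_re ((TemperateMatrix.const S).mul (hT.pow _))]
    refine integral_nonneg fun x => ?_
    obtain ⟨l₁, l₂, w, hw, hp₁, hp₂, h⟩ :=
      exists_weights (hpsd x).1 hSp.1 (1 : Matrix n n ℂ)
    have e : (S * X x ^ (2 * k)).trace =
        trace (1 * S ^ 1 * (1 : Matrix n n ℂ)ᴴ * (X x * X x) ^ k) := by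
      simp [pow_mul, pow_two]
    rw [e, h, Complex.ofReal_re]
    have := hp₁ (hpsd x)
    have := hp₂ hSp
    exact Finset.sum_nonneg fun u _ => Finset.sum_nonneg fun v _ =>
      mul_nonneg (mul_nonneg (hw u v) (pow_nonneg (by simp_all) _)) (pow_nonneg (by simp_all) _)
  have h4 : ∫ x, (X x ^ (2 * (k + 1))).trace.re ∂γ ≤
      K * (S * matrixMean γ (fun x => X x ^ (2 * k))).trace.re := by
    refine h1.trans ?_
    rw [← mul_assoc]
    gcongr
    push_cast
    linarith
  have h5 : (2 * K) = 8 * ((k + 1 : ℕ) : ℝ) := by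
    push_cast
    ring
  rw [h5] at h2
  -- Half of the moment on the right is absorbed on the left; this doubles the other term.
  linarith

omit [DecidableEq m] [DecidableEq n] in
theorem trace_fromBlocks (A : Matrix m m ℂ) (B : Matrix m n ℂ) (C : Matrix n m ℂ)
    (D : Matrix n n ℂ) : (fromBlocks A B C D).trace = A.trace + D.trace := by
  simp [Matrix.trace, Fintype.sum_sum_type]

/-- The noncommutative Khintchine inequality for rectangular Gaussian random matrices. -/
theorem integral_trace_mul_conjTranspose_pow_le {γ : Measure E} [IsGaussian γ] (hγ : γ[id] = 0)
    (X : E →ₗ[ℝ] Matrix m n ℂ) (k : ℕ) :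
    ∫ x, ((X x * (X x)ᴴ) ^ k).trace.re ∂γ ≤
      2 * (8 * (k : ℝ)) ^ k * ((matrixMean γ (fun x => X x * (X x)ᴴ) ^ k).trace.re +
        (matrixMean γ (fun x => (X x)ᴴ * X x) ^ k).trace.re) := by
  -- Hermitian dilation: its square is block diagonal with blocks `X Xᴴ` and `Xᴴ X`, which is why
  -- both covariances appear in the bound.
  let Y : E →ₗ[ℝ] Matrix (m ⊕ n) (m ⊕ n) ℂ :=
    { toFun := fun x => fromBlocks 0 (X x) (X x)ᴴ 0
      map_add' := fun x y => by simp [fromBlocks_add]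
      map_smul' := fun c x => by simp [fromBlocks_smul] }
  have hYY : ∀ x, Y x * Y x = fromBlocks (X x * (X x)ᴴ) 0 0 ((X x)ᴴ * X x) := fun x => by
    simp [Y, fromBlocks_multiply]
  have hY : ∀ x, (Y x).IsHermitian := fun x => by
    simp [Y, IsHermitian, fromBlocks_conjTranspose]
  have hmean : matrixMean γ (fun x => Y x * Y x) =
      fromBlocks (matrixMean γ (fun x => X x * (X x)ᴴ)) 0 0
        (matrixMean γ (fun x => (X x)ᴴ * X x)) := by
    simp only [hYY]
    ext (i | i) (j | j) <;> simp [matrixMean]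
  have h := integral_trace_pow_le hγ Y hY k
  rw [hmean, fromBlocks_diagonal_pow, trace_fromBlocks, Complex.add_re] at h
  refine le_trans ?_ h
  have hT := TemperateMatrix.linear X
  refine integral_mono (integrable_trace_re ((hT.mul hT.conjTranspose).pow k))
    (integrable_trace_re ((TemperateMatrix.linear Y).pow _)) fun x => ?_
  simp only [pow_mul, pow_two, hYY]
  rw [fromBlocks_diagonal_pow, trace_fromBlocks, Complex.add_re]
  have h0 : 0 ≤ (((X x)ᴴ * X x) ^ k).trace.re := by
        exact (Complex.le_def.1 ((posSemidef_conjTranspose_mul_self (X x)).pow k).trace_nonneg).1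
  linarith

end Khintchine

/-! ### Gaussianity and low moments of the Ginibre law. -/

section GinibreMoments

theorem isGaussian_pi {ι E : Type*} [Fintype ι] [NormedAddCommGroup E] [NormedSpace ℝ E]
    [MeasurableSpace E] [BorelSpace E] [SecondCountableTopology E] [CompleteSpace E]
    (γ : Measure E) [IsGaussian γ] : IsGaussian (Measure.pi fun _ : ι => γ) := by
  have hlaw : ∀ i : ι, HasGaussianLaw (fun x : ι → E => x i) (Measure.pi fun _ : ι => γ) :=
    fun i => ⟨by rw [(measurePreserving_eval (fun _ : ι => γ) i).map_eq]; infer_instance⟩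
  have hind : iIndepFun (fun i (x : ι → E) => x i) (Measure.pi fun _ : ι => γ) :=
    iIndepFun_pi (X := fun _ => id) fun _ => aemeasurable_id
  have := (iIndepFun.hasGaussianLaw hlaw hind).isGaussian_map
  rwa [show (fun (x : ι → E) => (fun i => x i)) = id from rfl, Measure.map_id] at this

theorem integral_id_pi {ι E : Type*} [Fintype ι] [NormedAddCommGroup E] [NormedSpace ℝ E]
    [MeasurableSpace E] [BorelSpace E] [SecondCountableTopology E] [CompleteSpace E]
    {γ : Measure E} [IsGaussian γ] (hγ : γ[id] = 0) : (Measure.pi fun _ : ι => γ)[id] = 0 := by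
  have := isGaussian_pi (ι := ι) γ
  funext i
  have h := (ContinuousLinearMap.proj (R := ℝ) (φ := fun _ : ι => E) i).integral_comp_comm
    (IsGaussian.integrable_id (μ := Measure.pi fun _ : ι => γ))
  rw [Pi.zero_apply, ← hγ]
  refine h.symm.trans ?_
  exact (measurePreserving_eval (fun _ : ι => γ) i).hasLaw.integral_comp (f := id) (by fun_prop)

theorem integral_id_prod {E F : Type*} [NormedAddCommGroup E] [NormedSpace ℝ E]
    [MeasurableSpace E] [BorelSpace E] [SecondCountableTopology E] [CompleteSpace E]
    [NormedAddCommGroup F] [NormedSpace ℝ F]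
    [MeasurableSpace F] [BorelSpace F] [SecondCountableTopology F] [CompleteSpace F]
    {γ : Measure E} [IsGaussian γ] (hγ : γ[id] = 0) {η : Measure F} [IsGaussian η]
    (hη : η[id] = 0) : (γ.prod η)[id] = 0 := by
  have hi := IsGaussian.integrable_id (μ := γ.prod η)
  ext1
  · refine ((ContinuousLinearMap.fst ℝ E F).integral_comp_comm hi).symm.trans ?_
    simpa using (integral_fun_fst (μ := γ) (ν := η) id).trans (by simpa using hγ)
  · refine ((ContinuousLinearMap.snd ℝ E F).integral_comp_comm hi).symm.trans ?_
    simpa using (integral_fun_snd (μ := γ) (ν := η) id).trans (by simpa using hη)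

instance isGaussian_stdComplexGaussian : IsGaussian stdComplexGaussian :=
  isGaussian_map_equiv Complex.equivRealProdCLM.symm

theorem integral_stdComplexGaussian {F : Type*} [NormedAddCommGroup F] [NormedSpace ℝ F]
    (f : ℂ → F) : ∫ z, f z ∂stdComplexGaussian = ∫ p : ℝ × ℝ, f (p.1 + p.2 * Complex.I)
      ∂((gaussianReal 0 (1 / 2)).prod (gaussianReal 0 (1 / 2))) := by
  rw [stdComplexGaussian, integral_map_equiv]
  refine integral_congr_ae (ae_of_all _ fun p => ?_)
  exact congrArg f (Complex.equivRealProdCLM_symm_apply p)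

theorem stdComplexGaussian_mean : stdComplexGaussian[id] = 0 := by
  have h0 : ∫ x, id x ∂(gaussianReal 0 (1 / 2)) = 0 := integral_id_gaussianReal
  have h : ∫ p, id p ∂((gaussianReal 0 (1 / 2)).prod (gaussianReal 0 (1 / 2))) = 0 :=
    integral_id_prod h0 h0
  rw [stdComplexGaussian, integral_map_equiv]
  refine ((Complex.equivRealProdCLM.symm : ℝ × ℝ →L[ℝ] ℂ).integral_comp_comm
    IsGaussian.integrable_id).trans ?_
  rw [h, map_zero]

theorem integral_mul_conj_stdComplexGaussian :
    ∫ z, z * (starRingEnd ℂ) z ∂stdComplexGaussian = 1 := by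
  have hsq : ∫ x, x ^ 2 ∂(gaussianReal 0 (1 / 2)) = 1 / 2 := by
    have := variance_fun_id_gaussianReal (μ := 0) (v := 1 / 2)
    rw [variance_eq_integral measurable_id'.aemeasurable] at this
    simpa [integral_id_gaussianReal] using this
  have hint : Integrable (fun x : ℝ => x ^ 2) (gaussianReal 0 (1 / 2)) :=
    (memLp_two_iff_integrable_sq (by fun_prop)).1
      (IsGaussian.memLp_id (gaussianReal 0 (1 / 2)) 2 (by simp))
  rw [integral_stdComplexGaussian]
  have : ∀ p : ℝ × ℝ, ((p.1 : ℂ) + p.2 * Complex.I) * (starRingEnd ℂ) (p.1 + p.2 * Complex.I) =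
      ((p.1 ^ 2 + p.2 ^ 2 : ℝ) : ℂ) := fun p => by
    rw [Complex.mul_conj, Complex.normSq_add_mul_I]
  simp only [this]
  rw [integral_complex_ofReal, integral_add (hint.comp_fst _) (hint.comp_snd _),
    integral_fun_fst (fun x : ℝ => x ^ 2), integral_fun_snd (fun x : ℝ => x ^ 2), hsq]
  norm_num

variable {m n : Type*} [Fintype m] [Fintype n]

/-- The Ginibre law, as a measure on the normed space of arrays. -/
abbrev ginibreArray (m n : Type*) [Fintype m] [Fintype n] : Measure (m → n → ℂ) :=
  Measure.pi fun _ : m => Measure.pi fun _ : n => stdComplexGaussian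

instance isGaussian_ginibreArray : IsGaussian (ginibreArray m n) :=
  have := isGaussian_pi (ι := n) stdComplexGaussian
  isGaussian_pi _

theorem ginibreArray_mean : (ginibreArray m n)[id] = 0 :=
  have := isGaussian_pi (ι := n) stdComplexGaussian
  integral_id_pi (integral_id_pi stdComplexGaussian_mean)

theorem measurePreserving_entry (i : m) (a : n) :
    MeasurePreserving (fun G : m → n → ℂ => G i a) (ginibreArray m n) stdComplexGaussian :=
  (measurePreserving_eval (fun _ : n => stdComplexGaussian) a).comp
    (measurePreserving_eval (fun _ : m => Measure.pi fun _ : n => stdComplexGaussian) i)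

/-- The continuous linear coordinate functionals on arrays. -/
def arrayEntry (i : m) (a : n) : (m → n → ℂ) →L[ℝ] ℂ :=
  (ContinuousLinearMap.proj (R := ℝ) (φ := fun _ : n => ℂ) a).comp
    (ContinuousLinearMap.proj (R := ℝ) (φ := fun _ : m => n → ℂ) i)

theorem temperate_entry (i : m) (a : n) : (fun G : m → n → ℂ => G i a).HasTemperateGrowth :=
  (arrayEntry i a).hasTemperateGrowth

theorem temperate_conj_entry (i : m) (a : n) :
    (fun G : m → n → ℂ => (starRingEnd ℂ) (G i a)).HasTemperateGrowth :=
  (Complex.conjCLE : ℂ →L[ℝ] ℂ).hasTemperateGrowth.comp (temperate_entry i a)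

theorem integral_entry (i : m) (a : n) : ∫ G, G i a ∂(ginibreArray m n) = 0 := by
  have h := (measurePreserving_entry i a).hasLaw.integral_comp (f := id) (by fun_prop)
  exact h.trans stdComplexGaussian_mean

/-- The entries are orthonormal in L²: distinct ones are independent and centred, whether they lie
in one row or in two. The covariance computations below use nothing else about the law. -/
theorem integral_entry_mul_conj [DecidableEq m] [DecidableEq n] (i j : m) (a b : n) :
    ∫ G, G i a * (starRingEnd ℂ) (G j b) ∂(ginibreArray m n) =
      if i = j ∧ a = b then 1 else 0 := by
  split_ifs with h
  · obtain ⟨rfl, rfl⟩ := h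
    have h := (measurePreserving_entry i a).hasLaw.integral_comp
      (f := fun z => z * (starRingEnd ℂ) z)
      (Continuous.aestronglyMeasurable (by fun_prop))
    exact h.trans integral_mul_conj_stdComplexGaussian
  · by_cases hij : i = j
    · subst hij
      have hab : a ≠ b := fun hab => h ⟨rfl, hab⟩
      have h1 : IndepFun (fun g : n → ℂ => g a) (fun g => (starRingEnd ℂ) (g b))
          (Measure.pi fun _ : n => stdComplexGaussian) :=
        ((iIndepFun_pi (X := fun _ => id) fun _ => aemeasurable_id).indepFun hab).comp
          (φ := id) measurable_id Complex.continuous_conj.measurable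
      have h2 := (measurePreserving_eval (fun _ : m => Measure.pi fun _ : n => stdComplexGaussian)
        i).hasLaw.integral_comp (f := fun g => g a * (starRingEnd ℂ) (g b))
        (Continuous.aestronglyMeasurable (by fun_prop))
      have h3 := (measurePreserving_eval (fun _ : n => stdComplexGaussian) a).hasLaw.integral_comp
        (f := id) (by fun_prop)
      refine h2.trans ((h1.integral_fun_mul_eq_mul_integral
        (Continuous.aestronglyMeasurable (by fun_prop))
        (Continuous.aestronglyMeasurable (by fun_prop))).trans ?_)
      rw [show ∫ g : n → ℂ, g a ∂(Measure.pi fun _ : n => stdComplexGaussian) = 0 from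
        h3.trans stdComplexGaussian_mean, zero_mul]
    · have h1 : IndepFun (fun G : m → n → ℂ => G i a) (fun G => (starRingEnd ℂ) (G j b))
          (ginibreArray m n) :=
        ((iIndepFun_pi (X := fun _ => id) fun _ => aemeasurable_id).indepFun hij).comp
          (φ := fun g : n → ℂ => g a) (ψ := fun g : n → ℂ => (starRingEnd ℂ) (g b))
          (measurable_pi_apply a) (Complex.continuous_conj.measurable.comp (measurable_pi_apply b))
      refine (h1.integral_fun_mul_eq_mul_integral
        (temperate_entry i a).1.continuous.aestronglyMeasurable
        (temperate_conj_entry j b).1.continuous.aestronglyMeasurable).trans ?_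
      rw [integral_entry, zero_mul]

/-- The fourth absolute moment of a standard complex Gaussian. -/
def gaussianFourthMoment : ℝ := ∫ z, ‖z‖ ^ 4 ∂stdComplexGaussian

theorem integral_norm_entry_pow_four (i : m) (a : n) :
    ∫ G, ‖G i a‖ ^ 4 ∂(ginibreArray m n) = gaussianFourthMoment :=
  (measurePreserving_entry i a).hasLaw.integral_comp (f := fun z : ℂ => ‖z‖ ^ 4)
    (Continuous.aestronglyMeasurable (by fun_prop))

end GinibreMoments

/-! ### Moments of the swapped matrix by two conditional uses of Khintchine. -/

section SwapMoments

open Matrix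
open scoped ComplexOrder

variable {α β κ : Type*}

/-- The matrix whose columns are the unnormalized swapped vectors of the columns of `G` and `H`. -/
def swapMat [Fintype α] (G H : α × β → κ → ℂ) : Matrix (β × β) (κ × κ) ℂ :=
  Matrix.of fun u w => ∑ j, G (j, u.1) w.1 * H (j, u.2) w.2

theorem swapMat_apply [Fintype α] (G H : α × β → κ → ℂ) (u : β × β) (w : κ × κ) :
    swapMat G H u w = ∑ j, G (j, u.1) w.1 * H (j, u.2) w.2 := rfl

/-- `swapMat` as a linear function of its first argument. -/
def swapLeft [Fintype α] (H : α × β → κ → ℂ) :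
    (α × β → κ → ℂ) →ₗ[ℝ] Matrix (β × β) (κ × κ) ℂ where
  toFun G := swapMat G H
  map_add' G G' := by
    ext u w
    simp [swapMat_apply, add_mul, Finset.sum_add_distrib]
  map_smul' c G := by
    ext u w
    simp [swapMat_apply, mul_assoc, Finset.mul_sum]

/-- `swapMat` as a linear function of its second argument. -/
def swapRight [Fintype α] (G : α × β → κ → ℂ) :
    (α × β → κ → ℂ) →ₗ[ℝ] Matrix (β × β) (κ × κ) ℂ where
  toFun H := swapMat G H
  map_add' H H' := by
    ext u w
    simp [swapMat_apply, mul_add, Finset.sum_add_distrib]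
  map_smul' c H := by
    ext u w
    simp [swapMat_apply, mul_left_comm, Finset.mul_sum]

/-- The rearrangement of an array into a matrix with rows indexed by the second row index. -/
def rowMat : (α × β → κ → ℂ) →ₗ[ℝ] Matrix β (α × κ) ℂ where
  toFun H := Matrix.of fun b w => H (w.1, b) w.2
  map_add' _ _ := rfl
  map_smul' _ _ := rfl

theorem rowMat_apply (H : α × β → κ → ℂ) (b : β) (w : α × κ) : rowMat H b w = H (w.1, b) w.2 := rfl

/-- The conjugate transpose of an array, as a real linear function. -/
def adjMat {m : Type*} : (m → κ → ℂ) →ₗ[ℝ] Matrix κ m ℂ where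
  toFun H := (Matrix.of H)ᴴ
  map_add' H H' := by
    ext
    simp
  map_smul' c H := by
    ext
    simp

theorem adjMat_apply {m : Type*} (H : m → κ → ℂ) (x : κ) (i : m) :
    adjMat H x i = (starRingEnd ℂ) (H i x) := rfl

variable [Fintype α] [Fintype β] [Fintype κ]

theorem temperate_swapMat :
    TemperateMatrix fun v : (α × β → κ → ℂ) × (α × β → κ → ℂ) => swapMat v.1 v.2 := by
  intro u w
  simp only [swapMat_apply]
  refine .sum fun j _ => .fun_mul ?_ ?_
  · exact (temperate_entry (j, u.1) w.1).comp (ContinuousLinearMap.fst ℝ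
      (α × β → κ → ℂ) (α × β → κ → ℂ)).hasTemperateGrowth
  · exact (temperate_entry (j, u.2) w.2).comp (ContinuousLinearMap.snd ℝ
      (α × β → κ → ℂ) (α × β → κ → ℂ)).hasTemperateGrowth

theorem integrable_entry_mul_conj {m n : Type*} [Fintype m] [Fintype n] (i j : m) (a b : n) :
    Integrable (fun G : m → n → ℂ => G i a * (starRingEnd ℂ) (G j b)) (ginibreArray m n) :=
  integrable_of_temperate ((temperate_entry i a).fun_mul (temperate_conj_entry j b))

variable [DecidableEq α] [DecidableEq β] [DecidableEq κ]

theorem matrixMean_rowMat_mul_conjTranspose :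
    matrixMean (ginibreArray (α × β) κ) (fun H => rowMat H * (rowMat H)ᴴ) =
      ((Fintype.card α * Fintype.card κ : ℕ) : ℂ) • 1 := by
  ext b b'
  simp only [matrixMean, Matrix.of_apply, Matrix.mul_apply, conjTranspose_apply, rowMat_apply,
    RCLike.star_def]
  rw [integral_finsetSum _ fun w _ => integrable_entry_mul_conj _ _ _ _]
  simp only [integral_entry_mul_conj]
  by_cases h : b = b' <;> simp [h]

theorem matrixMean_conjTranspose_mul_rowMat :
    matrixMean (ginibreArray (α × β) κ) (fun H => (rowMat H)ᴴ * rowMat H) =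
      (Fintype.card β : ℂ) • 1 := by
  ext w w'
  simp only [matrixMean, Matrix.of_apply, Matrix.mul_apply, conjTranspose_apply, rowMat_apply,
    RCLike.star_def, mul_comm ((starRingEnd ℂ) _)]
  rw [integral_finsetSum _ fun b _ => integrable_entry_mul_conj _ _ _ _]
  simp only [integral_entry_mul_conj, Prod.mk.injEq, and_true]
  by_cases h : w = w'
  · simp [h]
  · have : ¬ (w'.1 = w.1 ∧ w'.2 = w.2) := fun h' => h (Prod.ext h'.1.symm h'.2.symm)
    simp [h, this]

theorem matrixMean_adjMat_mul_conjTranspose {m : Type*} [Fintype m] [DecidableEq m] :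
    matrixMean (ginibreArray m κ) (fun H => adjMat H * (adjMat H)ᴴ) =
      (Fintype.card m : ℂ) • 1 := by
  ext x y
  simp only [matrixMean, Matrix.of_apply, Matrix.mul_apply, conjTranspose_apply, adjMat_apply,
    RCLike.star_def, Complex.conj_conj, mul_comm ((starRingEnd ℂ) _)]
  rw [integral_finsetSum _ fun b _ => integrable_entry_mul_conj _ _ _ _]
  simp only [integral_entry_mul_conj]
  by_cases h : y = x
  · simp [h]
  · simp [h, Ne.symm h]

theorem matrixMean_conjTranspose_mul_adjMat {m : Type*} [Fintype m] [DecidableEq m] :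
    matrixMean (ginibreArray m κ) (fun H => (adjMat H)ᴴ * adjMat H) =
      (Fintype.card κ : ℂ) • 1 := by
  ext x y
  simp only [matrixMean, Matrix.of_apply, Matrix.mul_apply, conjTranspose_apply, adjMat_apply,
    RCLike.star_def, Complex.conj_conj]
  rw [integral_finsetSum _ fun b _ => integrable_entry_mul_conj _ _ _ _]
  simp only [integral_entry_mul_conj]
  by_cases h : x = y <;> simp [h]

/-- Averaging over `G` forces `j = j'` and `u.1 = u'.1`. The free sum over `w.1` gives `card κ`, and
what remains is the Gram matrix of `H` with `α` moved to the columns. -/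
theorem matrixMean_swapLeft_mul_conjTranspose (H : α × β → κ → ℂ) :
    matrixMean (ginibreArray (α × β) κ) (fun G => swapLeft H G * (swapLeft H G)ᴴ) =
      (Fintype.card κ : ℂ) • ((1 : Matrix β β ℂ) ⊗ₖ (rowMat H * (rowMat H)ᴴ)) := by
  ext u u'
  have e : ∀ G : α × β → κ → ℂ, (swapLeft H G * (swapLeft H G)ᴴ) u u' =
      ∑ w : κ × κ, ∑ j, ∑ j', (H (j, u.2) w.2 * (starRingEnd ℂ) (H (j', u'.2) w.2)) *
        (G (j, u.1) w.1 * (starRingEnd ℂ) (G (j', u'.1) w.1)) := fun G => by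
    simp only [Matrix.mul_apply, conjTranspose_apply, swapLeft, LinearMap.coe_mk, AddHom.coe_mk,
      swapMat_apply, RCLike.star_def, map_sum, map_mul, Finset.sum_mul_sum]
    refine Finset.sum_congr rfl fun w _ => Finset.sum_congr rfl fun j _ =>
      Finset.sum_congr rfl fun j' _ => ?_
    ring
  have hi : ∀ (w : κ × κ) (j j' : α), Integrable (fun G : α × β → κ → ℂ =>
      (H (j, u.2) w.2 * (starRingEnd ℂ) (H (j', u'.2) w.2)) *
        (G (j, u.1) w.1 * (starRingEnd ℂ) (G (j', u'.1) w.1))) (ginibreArray (α × β) κ) :=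
    fun w j j' => (integrable_entry_mul_conj _ _ _ _).const_mul _
  simp only [matrixMean, Matrix.of_apply, e]
  rw [integral_finsetSum _ fun w _ => integrable_finsetSum _ fun j _ =>
    integrable_finsetSum _ fun j' _ => hi w j j']
  simp only [integral_finsetSum _ fun j _ => integrable_finsetSum _ fun j' _ => hi _ j j',
    integral_finsetSum _ fun j' _ => hi _ _ j', integral_const_mul, integral_entry_mul_conj]
  by_cases h : u.1 = u'.1
  · have h1 : (1 : Matrix β β ℂ) u.1 u'.1 = 1 := by rw [h, Matrix.one_apply_eq]
    simp [h, h1, Matrix.mul_apply, rowMat_apply, Fintype.sum_prod_type, Finset.mul_sum,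
      Finset.sum_comm (s := Finset.univ (α := κ)) (t := Finset.univ (α := α))]
  · simp [h]

/-- The contraction now forces `j = j'` and `w.1 = w'.1`, the free sum runs over `u.1`, and `α`
stays with the summed indices. -/
theorem matrixMean_conjTranspose_mul_swapLeft (H : α × β → κ → ℂ) :
    matrixMean (ginibreArray (α × β) κ) (fun G => (swapLeft H G)ᴴ * swapLeft H G) =
      (Fintype.card β : ℂ) • ((1 : Matrix κ κ ℂ) ⊗ₖ (adjMat H * (adjMat H)ᴴ)) := by
  ext w w'
  have e : ∀ G : α × β → κ → ℂ, ((swapLeft H G)ᴴ * swapLeft H G) w w' =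
      ∑ u : β × β, ∑ j, ∑ j', ((starRingEnd ℂ) (H (j, u.2) w.2) * H (j', u.2) w'.2) *
        (G (j', u.1) w'.1 * (starRingEnd ℂ) (G (j, u.1) w.1)) := fun G => by
    simp only [Matrix.mul_apply, conjTranspose_apply, swapLeft, LinearMap.coe_mk, AddHom.coe_mk,
      swapMat_apply, RCLike.star_def, map_sum, map_mul, Finset.sum_mul_sum]
    refine Finset.sum_congr rfl fun w _ => Finset.sum_congr rfl fun j _ =>
      Finset.sum_congr rfl fun j' _ => ?_
    ring
  have hi : ∀ (u : β × β) (j j' : α), Integrable (fun G : α × β → κ → ℂ =>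
      ((starRingEnd ℂ) (H (j, u.2) w.2) * H (j', u.2) w'.2) *
        (G (j', u.1) w'.1 * (starRingEnd ℂ) (G (j, u.1) w.1))) (ginibreArray (α × β) κ) :=
    fun u j j' => (integrable_entry_mul_conj _ _ _ _).const_mul _
  simp only [matrixMean, Matrix.of_apply, e]
  rw [integral_finsetSum _ fun w _ => integrable_finsetSum _ fun j _ =>
    integrable_finsetSum _ fun j' _ => hi w j j']
  simp only [integral_finsetSum _ fun j _ => integrable_finsetSum _ fun j' _ => hi _ j j',
    integral_finsetSum _ fun j' _ => hi _ _ j', integral_const_mul, integral_entry_mul_conj]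
  by_cases h : w.1 = w'.1
  · have h1 : (1 : Matrix κ κ ℂ) w.1 w'.1 = 1 := by rw [h, Matrix.one_apply_eq]
    simp [h, h1, Matrix.mul_apply, adjMat_apply, Fintype.sum_prod_type, Finset.mul_sum,
      Finset.sum_comm (s := Finset.univ (α := β)) (t := Finset.univ (α := α))]
  · simp [h, Ne.symm h]

theorem trace_smul_one_kronecker_pow {m n : Type*} [Fintype m] [Fintype n] [DecidableEq m]
    [DecidableEq n] (c : ℕ) (A : Matrix n n ℂ) (k : ℕ) :
    ((((c : ℂ) • ((1 : Matrix m m ℂ) ⊗ₖ A)) ^ k).trace).re =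
      (c : ℝ) ^ k * (Fintype.card m * (A ^ k).trace.re) := by
  have h : ((1 : Matrix m m ℂ) ⊗ₖ A) ^ k = 1 ⊗ₖ (A ^ k) := by
    induction k with
    | zero => simp
    | succ k ih => rw [pow_succ, ih, ← Matrix.mul_kronecker_mul, pow_succ, Matrix.one_mul]
  rw [smul_pow, h, trace_smul, trace_kronecker, trace_one, smul_eq_mul]
  have : ((c : ℂ) ^ k * ((Fintype.card m : ℂ) * (A ^ k).trace)) =
      (((c : ℝ) ^ k * Fintype.card m : ℝ) : ℂ) * (A ^ k).trace := by
    push_cast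
    ring
  rw [this, Complex.re_ofReal_mul]
  ring

theorem trace_smul_one_pow {n : Type*} [Fintype n] [DecidableEq n] (c : ℕ) (k : ℕ) :
    ((((c : ℂ) • (1 : Matrix n n ℂ)) ^ k).trace).re = (c : ℝ) ^ k * Fintype.card n := by
  rw [smul_pow, one_pow, trace_smul, trace_one, smul_eq_mul]
  norm_cast

/-- The constant in the noncommutative Khintchine inequality. -/
def khintchineConst (k : ℕ) : ℝ := 2 * (8 * (k : ℝ)) ^ k

theorem khintchineConst_nonneg (k : ℕ) : 0 ≤ khintchineConst k := by
  unfold khintchineConst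
  positivity

-- For fixed `H` Khintchine in `G` yields moments of `rowMat H` and `adjMat H`; these are linear in
-- `H`, and Khintchine in `H` meets only scalar covariances. Hence the squared constant and four
-- products of dimensions.
omit [DecidableEq α] in
theorem integral_trace_swapMat_pow_le (k : ℕ) :
    ∫ v, ((swapMat v.1 v.2 * (swapMat v.1 v.2)ᴴ) ^ k).trace.re
      ∂((ginibreArray (α × β) κ).prod (ginibreArray (α × β) κ)) ≤
    khintchineConst k ^ 2 *
      ((Fintype.card κ : ℝ) ^ k * (Fintype.card β *
        (((Fintype.card α * Fintype.card κ : ℕ) : ℝ) ^ k * Fintype.card β +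
          (Fintype.card β : ℝ) ^ k * Fintype.card (α × κ))) +
      (Fintype.card β : ℝ) ^ k * (Fintype.card κ *
        ((Fintype.card (α × β) : ℝ) ^ k * Fintype.card κ +
          (Fintype.card κ : ℝ) ^ k * Fintype.card (α × β)))) := by
  classical
  set γ := ginibreArray (α × β) κ
  set C := khintchineConst k with hC
  have hC0 : 0 ≤ C := khintchineConst_nonneg k
  have hT := temperate_swapMat (α := α) (β := β) (κ := κ)
  have hi := integrable_trace_re (γ := γ.prod γ) ((hT.mul hT.conjTranspose).pow k)
  have hR := TemperateMatrix.linear (rowMat (α := α) (β := β) (κ := κ))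
  have hA := TemperateMatrix.linear (adjMat (m := α × β) (κ := κ))
  have hRi := integrable_trace_re (γ := γ) ((hR.mul hR.conjTranspose).pow k)
  have hAi := integrable_trace_re (γ := γ) ((hA.mul hA.conjTranspose).pow k)
  have h1 : ∫ H, ((rowMat H * (rowMat H)ᴴ) ^ k).trace.re ∂γ ≤ C *
      (((Fintype.card α * Fintype.card κ : ℕ) : ℝ) ^ k * Fintype.card β +
          (Fintype.card β : ℝ) ^ k * Fintype.card (α × κ)) := by
    refine (integral_trace_mul_conjTranspose_pow_le ginibreArray_mean rowMat k).trans_eq ?_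
    rw [matrixMean_rowMat_mul_conjTranspose, matrixMean_conjTranspose_mul_rowMat,
      trace_smul_one_pow, trace_smul_one_pow, hC, khintchineConst]
  have h2 : ∫ H, ((adjMat H * (adjMat H)ᴴ) ^ k).trace.re ∂γ ≤ C *
      ((Fintype.card (α × β) : ℝ) ^ k * Fintype.card κ +
          (Fintype.card κ : ℝ) ^ k * Fintype.card (α × β)) := by
    refine (integral_trace_mul_conjTranspose_pow_le ginibreArray_mean adjMat k).trans_eq ?_
    rw [matrixMean_adjMat_mul_conjTranspose, matrixMean_conjTranspose_mul_adjMat,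
      trace_smul_one_pow, trace_smul_one_pow, hC, khintchineConst]
  rw [integral_prod_symm _ hi]
  calc ∫ H, ∫ G, ((swapMat G H * (swapMat G H)ᴴ) ^ k).trace.re ∂γ ∂γ
      ≤ ∫ H, C * ((Fintype.card κ : ℝ) ^ k * (Fintype.card β *
          ((rowMat H * (rowMat H)ᴴ) ^ k).trace.re) + (Fintype.card β : ℝ) ^ k * (Fintype.card κ *
          ((adjMat H * (adjMat H)ᴴ) ^ k).trace.re)) ∂γ := by
        refine integral_mono hi.integral_prod_right ?_ fun H => ?_
        · exact (((hRi.const_mul _).const_mul _).add ((hAi.const_mul _).const_mul _)).const_mul _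
        · refine (integral_trace_mul_conjTranspose_pow_le ginibreArray_mean
            (swapLeft H) k).trans_eq ?_
          rw [matrixMean_swapLeft_mul_conjTranspose, matrixMean_conjTranspose_mul_swapLeft,
            trace_smul_one_kronecker_pow, trace_smul_one_kronecker_pow, hC, khintchineConst]
    _ = C * ((Fintype.card κ : ℝ) ^ k * (Fintype.card β *
          ∫ H, ((rowMat H * (rowMat H)ᴴ) ^ k).trace.re ∂γ) + (Fintype.card β : ℝ) ^ k *
          (Fintype.card κ * ∫ H, ((adjMat H * (adjMat H)ᴴ) ^ k).trace.re ∂γ)) := by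
        rw [integral_const_mul, integral_add ((hRi.const_mul _).const_mul _)
          ((hAi.const_mul _).const_mul _)]
        simp only [integral_const_mul]
    _ ≤ C * ((Fintype.card κ : ℝ) ^ k * (Fintype.card β *
          (C * (((Fintype.card α * Fintype.card κ : ℕ) : ℝ) ^ k * Fintype.card β +
          (Fintype.card β : ℝ) ^ k * Fintype.card (α × κ)))) + (Fintype.card β : ℝ) ^ k *
          (Fintype.card κ * (C * ((Fintype.card (α × β) : ℝ) ^ k * Fintype.card κ +
          (Fintype.card κ : ℝ) ^ k * Fintype.card (α × β))))) := by
        gcongr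
    _ = _ := by ring

/-- All moments of the swapped matrix are of order `d ^ 2` after rescaling by `d ^ 3`. -/
theorem integral_trace_swapMat_pow_succ_le {d s : ℕ} {c : ℝ} (hc : 1 ≤ c) (hs : (s : ℝ) ≤ c * d)
    (k : ℕ) :
    ∫ v, ((swapMat v.1 v.2 * (swapMat v.1 v.2)ᴴ) ^ (k + 1)).trace.re
      ∂((ginibreArray (Fin d × Fin d) (Fin s)).prod (ginibreArray (Fin d × Fin d) (Fin s))) ≤
    4 * khintchineConst (k + 1) ^ 2 * c ^ (2 * (k + 1)) * (d : ℝ) ^ (3 * (k + 1) + 2) := by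
  refine (integral_trace_swapMat_pow_le (k + 1)).trans ?_
  simp only [Fintype.card_prod, Fintype.card_fin]
  push_cast
  have hd : (0 : ℝ) ≤ d := Nat.cast_nonneg d
  have hs0 : (0 : ℝ) ≤ s := Nat.cast_nonneg s
  -- Two of the four terms only reach `d^(2k+5)`. They fit because the exponent is `k + 1 ≥ 1`; at
  -- exponent 0 the Khintchine bound would be of order `d³`, not `d²`.
  have hd' : (d : ℝ) ^ (2 * k + 5) ≤ (d : ℝ) ^ (3 * k + 5) := by
    rcases Nat.eq_zero_or_pos d with rfl | h
    · simp
    · exact pow_le_pow_right₀ (by exact_mod_cast h) (by omega)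
  have e : ∀ i j : ℕ, (s : ℝ) ^ i * (d : ℝ) ^ j ≤ c ^ i * (d : ℝ) ^ (i + j) := fun i j => by
    calc (s : ℝ) ^ i * (d : ℝ) ^ j ≤ (c * d) ^ i * (d : ℝ) ^ j := by gcongr
      _ = _ := by ring
  have t1 : (s : ℝ) ^ (2 * k + 2) * (d : ℝ) ^ (k + 3) ≤ c ^ (2 * k + 2) * (d : ℝ) ^ (3 * k + 5) :=
    (e _ _).trans_eq (by ring)
  have t2 : (s : ℝ) ^ (k + 2) * (d : ℝ) ^ (k + 3) ≤ c ^ (2 * k + 2) * (d : ℝ) ^ (3 * k + 5) := by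
    calc _ ≤ c ^ (k + 2) * (d : ℝ) ^ (k + 2 + (k + 3)) := e _ _
      _ = c ^ (k + 2) * (d : ℝ) ^ (2 * k + 5) := by ring
      _ ≤ _ := by
        gcongr
        omega
  have t3 : (s : ℝ) ^ 2 * (d : ℝ) ^ (3 * k + 3) ≤ c ^ (2 * k + 2) * (d : ℝ) ^ (3 * k + 5) := by
    calc _ ≤ c ^ 2 * (d : ℝ) ^ (2 + (3 * k + 3)) := e _ _
      _ = c ^ 2 * (d : ℝ) ^ (3 * k + 5) := by ring
      _ ≤ _ := by
        gcongr
        omega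
  calc _ = khintchineConst (k + 1) ^ 2 * ((s : ℝ) ^ (2 * k + 2) * (d : ℝ) ^ (k + 3) +
        2 * ((s : ℝ) ^ (k + 2) * (d : ℝ) ^ (k + 3)) + (s : ℝ) ^ 2 * (d : ℝ) ^ (3 * k + 3)) := by ring
    _ ≤ khintchineConst (k + 1) ^ 2 * (4 * (c ^ (2 * k + 2) * (d : ℝ) ^ (3 * k + 5))) := by
        gcongr
        linarith
    _ = _ := by ring

end SwapMoments

/-! ### Swapping of Gram matrices, and deterministic bounds for the shifted Gram matrix. -/

section Algebra

open Matrix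
open scoped ComplexOrder

theorem bell_apply {d : ℕ} (l j : Fin d × Fin d) :
    bell d l j = if l.1 = l.2 ∧ j.1 = j.2 then 1 else 0 := by
  simp only [bell, Matrix.sum_apply, kroneckerMap_apply, Matrix.single_apply]
  split_ifs with h
  · rw [Finset.sum_eq_single l.1, Finset.sum_eq_single j.1]
    · simp [h.1, h.2]
    · intro b _ hb
      simp [hb]
    · simp
    · intro b _ hb
      simp [hb]
    · simp
  · refine Finset.sum_eq_zero fun i _ => Finset.sum_eq_zero fun i' _ => ?_
    by_cases h1 : i = l.1 ∧ i' = j.1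
    · rw [if_neg (c := i = l.2 ∧ i' = j.2), mul_zero]
      rintro ⟨h3, h4⟩
      exact h ⟨h1.1.symm.trans h3, h1.2.symm.trans h4⟩
    · rw [if_neg h1, zero_mul]

/-- The Bell operator together with the trace identifies the traced row indices of `A` and `B` with
each other, and likewise their column indices. -/
theorem swapping_apply {d : ℕ} (A B : Matrix (Fin d × Fin d) (Fin d × Fin d) ℂ)
    (u u' : Fin d × Fin d) :
    swapping A B u u' =
      (1 / (d : ℂ)) * ∑ j, ∑ l, A (j, u.1) (l, u'.1) * B (j, u.2) (l, u'.2) := by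
  simp only [swapping, partialTrace, regroupedTensor, Matrix.smul_apply, Matrix.of_apply,
    smul_eq_mul, Matrix.mul_apply, kroneckerMap_apply, reindex_apply, submatrix_apply, bell_apply,
    Matrix.one_apply]
  congr 1
  simp [Fintype.sum_prod_type, Prod.ext_iff, ite_and]

/-- Row and column indices are summed separately, so the double sum factors through pairs of columns
of `G` and `H`. -/
theorem swapping_gram {d s : ℕ} (G H : Fin d × Fin d → Fin s → ℂ) :
    swapping (Matrix.of G * (Matrix.of G)ᴴ) (Matrix.of H * (Matrix.of H)ᴴ) =
      (1 / (d : ℂ)) • (swapMat G H * (swapMat G H)ᴴ) := by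
  ext u u'
  rw [swapping_apply, Matrix.smul_apply, smul_eq_mul]
  congr 1
  simp only [Matrix.mul_apply, conjTranspose_apply, swapMat_apply, RCLike.star_def, map_sum,
    map_mul, Finset.sum_mul_sum, Matrix.of_apply, Fintype.sum_prod_type]
  simp only [Finset.sum_comm (s := Finset.univ (α := Fin s)) (t := Finset.univ (α := Fin d))]
  refine Finset.sum_congr rfl fun j _ => Finset.sum_congr rfl fun l _ =>
    Finset.sum_congr rfl fun x _ => Finset.sum_congr rfl fun y _ => ?_
  ring

variable {m n : Type*} [Fintype m] [Fintype n] [DecidableEq m]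

/-- The affine function `a K Kᴴ - b` of the Gram matrix of `K`. -/
def shiftedGram (a b : ℝ) (K : Matrix m n ℂ) : Matrix m m ℂ :=
  (a : ℂ) • (K * Kᴴ) - (b : ℂ) • 1

omit [Fintype m] in
theorem shiftedGram_isHermitian (a b : ℝ) (K : Matrix m n ℂ) : (shiftedGram a b K).IsHermitian := by
  simp [shiftedGram, IsHermitian, conjTranspose_sub, conjTranspose_smul, conjTranspose_mul]

/-- For positive `d` and `s` the two coefficients are `1/(d² s)` and `s/d`. -/
theorem rescaled_gram {d s : ℕ} (G H : Fin d × Fin d → Fin s → ℂ) :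
    rescaled s (Matrix.of G * (Matrix.of G)ᴴ) (Matrix.of H * (Matrix.of H)ᴴ) =
      shiftedGram ((d * s) * (1 / (d ^ 2 * s ^ 2)) * (1 / d)) ((d * s) * (1 / d ^ 2))
        (swapMat G H) := by
  rw [rescaled, swapping_gram, shiftedGram, smul_sub, smul_smul, smul_smul, smul_smul]
  push_cast
  rfl

/-- The squared Frobenius norm. -/
def frobSq {m n : Type*} [Fintype m] [Fintype n] (A : Matrix m n ℂ) : ℝ := ∑ i, ∑ j, ‖A i j‖ ^ 2

omit [DecidableEq m] in
theorem frobSq_eq_trace (A : Matrix m n ℂ) : frobSq A = (A * Aᴴ).trace.re := by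
  simp only [frobSq, Matrix.trace, diag_apply, Matrix.mul_apply, Complex.re_sum,
    conjTranspose_apply, RCLike.star_def, Complex.mul_conj, Complex.ofReal_re, Complex.sq_norm]

omit [DecidableEq m] in
/-- The square of the Frobenius norm of `Kᴴ Zᵠ`, for `Z = a K Kᴴ - b`, is controlled by moments of
the Gram matrix. -/
theorem frobSq_conjTranspose_mul_shiftedGram_pow_le [DecidableEq m] {a b c t : ℝ} (hc : 0 ≤ c)
    (ht : 0 < t) (ha : |a| * t ≤ c) (hb : |b| ≤ c) (K : Matrix m n ℂ) (q : ℕ) :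
    frobSq (Kᴴ * shiftedGram a b K ^ q) ^ 2 ≤
      t ^ 2 * c ^ (4 * q) * 2 ^ (4 * q + 2) * Fintype.card m *
        (Fintype.card m + (t⁻¹) ^ (4 * q + 2) * ((K * Kᴴ) ^ (4 * q + 2)).trace.re) := by
  have hP := posSemidef_self_mul_conjTranspose K
  obtain ⟨U, l, hl, hU, hU', hpow⟩ := exists_diagonalization hP.1
  replace hl := hl hP
  have hP1 : K * Kᴴ = U * diagonal (fun i => (l i : ℂ)) * Uᴴ := by
    simpa using hpow 1
  have hZ : shiftedGram a b K = U * diagonal (fun i => ((a * l i - b : ℝ) : ℂ)) * Uᴴ := by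
    have h1 : diagonal (fun i => ((a * l i - b : ℝ) : ℂ)) =
        (a : ℂ) • diagonal (fun i => (l i : ℂ)) - (b : ℂ) • (1 : Matrix m m ℂ) := by
      ext i j
      by_cases h : i = j <;> simp [h]
    rw [shiftedGram, hP1, h1, Matrix.mul_sub, Matrix.sub_mul, Matrix.mul_smul, Matrix.smul_mul,
      Matrix.mul_smul, Matrix.smul_mul, Matrix.mul_one, hU]
  have hZk : ∀ k : ℕ, shiftedGram a b K ^ k =
      U * diagonal (fun i => (((a * l i - b) ^ k : ℝ) : ℂ)) * Uᴴ := fun k => by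
    induction k with
    | zero => simp [hU]
    | succ k ih =>
      rw [pow_succ, ih, hZ]
      calc _ = U * diagonal (fun i => (((a * l i - b) ^ k : ℝ) : ℂ)) * (Uᴴ * U) *
            diagonal (fun i => ((a * l i - b : ℝ) : ℂ)) * Uᴴ := by
            simp only [Matrix.mul_assoc]
        _ = _ := by
            rw [hU', Matrix.mul_one, Matrix.mul_assoc U, diagonal_mul_diagonal]
            simp only [pow_succ, Complex.ofReal_mul]
  have hfrob : frobSq (Kᴴ * shiftedGram a b K ^ q) = ∑ i, (a * l i - b) ^ (2 * q) * l i := by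
    rw [frobSq_eq_trace, conjTranspose_mul, conjTranspose_conjTranspose, conjTranspose_pow,
      (shiftedGram_isHermitian a b K).eq]
    have : Kᴴ * shiftedGram a b K ^ q * (shiftedGram a b K ^ q * K) =
        Kᴴ * (shiftedGram a b K ^ (2 * q) * K) := by
      rw [two_mul, pow_add]
      simp only [Matrix.mul_assoc]
    rw [this, trace_mul_comm, Matrix.mul_assoc, hZk, hP1]
    have : U * diagonal (fun i => (((a * l i - b) ^ (2 * q) : ℝ) : ℂ)) * Uᴴ *
        (U * diagonal (fun i => (l i : ℂ)) * Uᴴ) =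
        U * (diagonal (fun i => (((a * l i - b) ^ (2 * q) : ℝ) : ℂ)) * (Uᴴ * U) *
          diagonal (fun i => (l i : ℂ)) * Uᴴ) := by
      simp only [Matrix.mul_assoc]
    rw [this, hU', Matrix.mul_one, trace_mul_comm, Matrix.mul_assoc, hU', Matrix.mul_one,
      diagonal_mul_diagonal, trace_diagonal, Complex.re_sum]
    refine Finset.sum_congr rfl fun i _ => ?_
    rw [← Complex.ofReal_mul, Complex.ofReal_re]
  have htr : ((K * Kᴴ) ^ (4 * q + 2)).trace.re = ∑ i, l i ^ (4 * q + 2) := by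
    rw [hpow, trace_mul_comm, ← Matrix.mul_assoc, hU', Matrix.one_mul, trace_diagonal,
      Complex.re_sum]
    simp only [Complex.ofReal_re]
  -- Measure eigenvalues in units of `t`: with `w = l i / t` the shifted eigenvalue is at most `c (1
  -- + w)`, and the square has degree `4q + 2` in `1 + w`.
  have hterm : ∀ i, ((a * l i - b) ^ (2 * q) * l i) ^ 2 ≤
      t ^ 2 * c ^ (4 * q) * 2 ^ (4 * q + 2) * (1 + (t⁻¹) ^ (4 * q + 2) * l i ^ (4 * q + 2)) := by
    intro i
    set w := t⁻¹ * l i with hw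
    have hw0 : 0 ≤ w := mul_nonneg (inv_nonneg.2 ht.le) (hl i)
    have hlw : l i = t * w := by
      rw [hw]
      field_simp
    have h1 : |a * l i - b| ≤ c * (1 + w) := by
      calc |a * l i - b| ≤ |a * l i| + |b| := abs_sub _ _
        _ = |a| * t * w + |b| := by
          rw [hlw, abs_mul, abs_of_nonneg (mul_nonneg ht.le hw0), mul_assoc]
        _ ≤ c * w + c := by gcongr
        _ = _ := by ring
    have h2 : (1 + w) ^ (4 * q + 2) ≤ 2 ^ (4 * q + 2) * (1 + w ^ (4 * q + 2)) := by
      rcases le_total w 1 with h | h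
      · calc (1 + w) ^ (4 * q + 2) ≤ 2 ^ (4 * q + 2) := by gcongr; linarith
          _ ≤ _ := le_mul_of_one_le_right (by positivity) (by linarith [pow_nonneg hw0 (4 * q + 2)])
      · calc (1 + w) ^ (4 * q + 2) ≤ (2 * w) ^ (4 * q + 2) := by gcongr; linarith
          _ = 2 ^ (4 * q + 2) * w ^ (4 * q + 2) := mul_pow _ _ _
          _ ≤ _ := by gcongr; linarith
    calc ((a * l i - b) ^ (2 * q) * l i) ^ 2 = |a * l i - b| ^ (4 * q) * (t * w) ^ 2 := by
          rw [← hlw, (show Even (4 * q) from ⟨2 * q, by ring⟩).pow_abs]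
          ring
      _ ≤ (c * (1 + w)) ^ (4 * q) * (t * (1 + w)) ^ 2 := by
          gcongr
          linarith
      _ = t ^ 2 * c ^ (4 * q) * (1 + w) ^ (4 * q + 2) := by
          rw [mul_pow, pow_add]
          ring
      _ ≤ t ^ 2 * c ^ (4 * q) * (2 ^ (4 * q + 2) * (1 + w ^ (4 * q + 2))) := by gcongr
      _ = _ := by
          rw [hw, mul_pow]
          ring
  rw [hfrob, htr]
  calc (∑ i, (a * l i - b) ^ (2 * q) * l i) ^ 2
      ≤ Fintype.card m * ∑ i, ((a * l i - b) ^ (2 * q) * l i) ^ 2 := by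
        simpa using sq_sum_le_card_mul_sum_sq (s := Finset.univ)
          (f := fun i => (a * l i - b) ^ (2 * q) * l i)
    _ ≤ Fintype.card m * ∑ i, t ^ 2 * c ^ (4 * q) * 2 ^ (4 * q + 2) *
          (1 + (t⁻¹) ^ (4 * q + 2) * l i ^ (4 * q + 2)) := by
        gcongr with i
        exact hterm i
    _ = _ := by
        rw [← Finset.mul_sum, Finset.sum_add_distrib, ← Finset.mul_sum]
        simp
        ring

/-- By cyclicity all `q + 1` positions of the increment contribute equally, and `K' Kᴴ` and `K K'ᴴ`
give conjugate numbers. Thus `Kᴴ Z^q` alone represents the gradient. -/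
theorem norm_trace_deriv_le (a b : ℝ) (K K' : Matrix m n ℂ) (q : ℕ) :
    ‖(∑ i ∈ Finset.range (q + 1), shiftedGram a b K ^ i * ((a : ℂ) • (K' * Kᴴ + K * K'ᴴ)) *
      shiftedGram a b K ^ (q - i)).trace‖ ≤
      2 * (q + 1) * |a| * ‖((Kᴴ * shiftedGram a b K ^ q) * K').trace‖ := by
  set Z := shiftedGram a b K with hZ
  have hZH : Zᴴ = Z := (shiftedGram_isHermitian a b K).eq
  set τ := ((Kᴴ * Z ^ q) * K').trace with hτ
  have h1 : (Z ^ q * (K' * Kᴴ)).trace = τ := by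
    rw [hτ, ← Matrix.mul_assoc, trace_mul_comm, ← Matrix.mul_assoc]
  have h2 : (Z ^ q * (K * K'ᴴ)).trace = (starRingEnd ℂ) τ := by
    rw [hτ, ← RCLike.star_def, ← trace_conjTranspose, conjTranspose_mul, conjTranspose_mul,
      conjTranspose_pow, hZH, conjTranspose_conjTranspose, ← Matrix.mul_assoc, ← Matrix.mul_assoc,
      trace_mul_comm, ← Matrix.mul_assoc, Matrix.mul_assoc, trace_mul_comm, Matrix.mul_assoc,
      trace_mul_comm]
  have h3 : ∀ i ∈ Finset.range (q + 1),
      (Z ^ i * ((a : ℂ) • (K' * Kᴴ + K * K'ᴴ)) * Z ^ (q - i)).trace =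
        (a : ℂ) * (τ + (starRingEnd ℂ) τ) := fun i hi => by
    have : q - i + i = q := Nat.sub_add_cancel (Nat.lt_succ_iff.1 (Finset.mem_range.1 hi))
    rw [trace_mul_comm, ← Matrix.mul_assoc, ← pow_add, this, Matrix.mul_smul, trace_smul,
      Matrix.mul_add, trace_add, h1, h2, smul_eq_mul]
  rw [trace_sum, Finset.sum_congr rfl h3, Finset.sum_const, Finset.card_range, nsmul_eq_mul,
    norm_mul, norm_mul, Complex.norm_natCast, Complex.norm_real, Real.norm_eq_abs]
  have h4 : ‖τ + (starRingEnd ℂ) τ‖ ≤ 2 * ‖τ‖ := by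
    refine (norm_add_le _ _).trans ?_
    rw [RCLike.norm_conj, two_mul]
  push_cast
  calc ((q : ℝ) + 1) * (|a| * ‖τ + (starRingEnd ℂ) τ‖) ≤ ((q : ℝ) + 1) * (|a| * (2 * ‖τ‖)) := by
        gcongr
    _ = _ := by ring

end Algebra

/-! ### The Dirichlet energy of the trace moments. -/

section GradientBound

open Matrix

theorem integral_norm_sq_linear {m n : Type*} [Fintype m] [Fintype n] (c : m → n → ℂ) :
    ∫ G, ‖∑ i, ∑ x, c i x * G i x‖ ^ 2 ∂(ginibreArray m n) = ∑ i, ∑ x, ‖c i x‖ ^ 2 := by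
  classical
  have e : ∀ G : m → n → ℂ, ((‖∑ i, ∑ x, c i x * G i x‖ ^ 2 : ℝ) : ℂ) =
      ∑ p : m × n, ∑ q : m × n, (c p.1 p.2 * (starRingEnd ℂ) (c q.1 q.2)) *
        (G p.1 p.2 * (starRingEnd ℂ) (G q.1 q.2)) := fun G => by
    rw [Complex.sq_norm, ← Complex.mul_conj, ← Fintype.sum_prod_type', map_sum, Finset.sum_mul_sum]
    refine Finset.sum_congr rfl fun p _ => Finset.sum_congr rfl fun q _ => ?_
    rw [map_mul]
    ring
  have hi : ∀ p q : m × n, Integrable (fun G : m → n → ℂ =>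
      (c p.1 p.2 * (starRingEnd ℂ) (c q.1 q.2)) * (G p.1 p.2 * (starRingEnd ℂ) (G q.1 q.2)))
      (ginibreArray m n) := fun p q => (integrable_entry_mul_conj _ _ _ _).const_mul _
  apply Complex.ofReal_injective
  rw [← integral_complex_ofReal]
  simp only [e]
  rw [integral_finsetSum _ fun p _ => integrable_finsetSum _ fun q _ => hi p q]
  simp only [integral_finsetSum _ fun q _ => hi _ q, integral_const_mul, integral_entry_mul_conj,
    ← Prod.ext_iff, mul_ite, mul_one, mul_zero, Finset.sum_ite_eq, Finset.mem_univ, if_true]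
  rw [Fintype.sum_prod_type]
  push_cast
  refine Finset.sum_congr rfl fun i _ => Finset.sum_congr rfl fun x _ => ?_
  rw [Complex.mul_conj, ← Complex.sq_norm]
  push_cast
  rfl

theorem norm_sum_mul_sq_le {ι : Type*} [Fintype ι] (f g : ι → ℂ) :
    ‖∑ i, f i * g i‖ ^ 2 ≤ (∑ i, ‖f i‖ ^ 2) * ∑ i, ‖g i‖ ^ 2 := by
  calc ‖∑ i, f i * g i‖ ^ 2 ≤ (∑ i, ‖f i‖ * ‖g i‖) ^ 2 := by
        gcongr
        refine (norm_sum_le _ _).trans_eq ?_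
        simp only [norm_mul]
    _ ≤ _ := Finset.sum_mul_sq_le_sq_mul_sq _ _ _

variable {α β κ : Type*} [Fintype α] [Fintype β] [Fintype κ]

/-- For fixed `H` the trace is a linear form in `G`, so its second moment is the sum of its squared
coefficients. Cauchy–Schwarz splits each coefficient into an `H` part depending on `i.1` only and an
`M` part depending on `i.2` and `x` only, so the sum factors. -/
theorem integral_norm_trace_mul_swapLeft_sq_le (M : Matrix (κ × κ) (β × β) ℂ)
    (H : α × β → κ → ℂ) :
    ∫ G, ‖(M * swapMat G H).trace‖ ^ 2 ∂(ginibreArray (α × β) κ) ≤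
      frobSq (Matrix.of H) * frobSq M := by
  have e : ∀ G : α × β → κ → ℂ, (M * swapMat G H).trace = ∑ i, ∑ x,
      (∑ r : β × κ, M (x, r.2) (i.2, r.1) * H (i.1, r.1) r.2) * G i x := fun G => by
    simp only [Matrix.trace, diag_apply, Matrix.mul_apply, swapMat_apply, Finset.mul_sum,
      Finset.sum_mul, Fintype.sum_prod_type]
    simp only [Finset.sum_comm (s := Finset.univ (α := κ)) (t := Finset.univ (α := β)),
      Finset.sum_comm (s := Finset.univ (α := κ)) (t := Finset.univ (α := α)),
      Finset.sum_comm (s := Finset.univ (α := β)) (t := Finset.univ (α := α))]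
    refine Finset.sum_congr rfl fun j _ => Finset.sum_congr rfl fun a _ => ?_
    refine Finset.sum_congr rfl fun b _ => ?_
    refine Finset.sum_congr rfl fun x _ => Finset.sum_congr rfl fun y _ => ?_
    ring
  simp only [e]
  rw [integral_norm_sq_linear]
  calc _ ≤ ∑ i : α × β, ∑ x, (∑ r : β × κ, ‖M (x, r.2) (i.2, r.1)‖ ^ 2) *
        ∑ r : β × κ, ‖H (i.1, r.1) r.2‖ ^ 2 :=
        Finset.sum_le_sum fun i _ => Finset.sum_le_sum fun x _ => norm_sum_mul_sq_le _ _
    _ = _ := by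
        simp only [← Finset.sum_mul, frobSq, Fintype.sum_prod_type, Matrix.of_apply]
        simp only [← Finset.mul_sum]
        rw [mul_comm]
        congr 1
        rw [Finset.sum_comm]
        refine Finset.sum_congr rfl fun x _ => ?_
        simp only [Finset.sum_comm (s := Finset.univ (α := β)) (t := Finset.univ (α := κ))]

/-- Exchanging the two tensor legs exchanges `G` and `H`, which reduces the estimate in `H` to the
one in `G`. -/
theorem trace_mul_swapMat_swap (M : Matrix (κ × κ) (β × β) ℂ) (G H : α × β → κ → ℂ) :
    (M * swapMat G H).trace = (M.submatrix Prod.swap Prod.swap * swapMat H G).trace := by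
  simp only [Matrix.trace, diag_apply, Matrix.mul_apply, swapMat_apply, submatrix_apply]
  rw [← (Equiv.prodComm κ κ).sum_comp]
  refine Finset.sum_congr rfl fun w _ => ?_
  rw [← (Equiv.prodComm β β).sum_comp]
  refine Finset.sum_congr rfl fun u _ => ?_
  simp only [Equiv.prodComm_apply, Prod.fst_swap, Prod.snd_swap, mul_comm (G _ _)]

theorem frobSq_submatrix_swap (M : Matrix (κ × κ) (β × β) ℂ) :
    frobSq (M.submatrix Prod.swap Prod.swap) = frobSq M := by
  simp only [frobSq, submatrix_apply]
  rw [← (Equiv.prodComm κ κ).sum_comp]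
  refine Finset.sum_congr rfl fun w _ => ?_
  rw [← (Equiv.prodComm β β).sum_comp]
  simp

theorem integral_norm_trace_mul_swapRight_sq_le (M : Matrix (κ × κ) (β × β) ℂ)
    (G : α × β → κ → ℂ) :
    ∫ H, ‖(M * swapMat G H).trace‖ ^ 2 ∂(ginibreArray (α × β) κ) ≤
      frobSq (Matrix.of G) * frobSq M := by
  simp only [trace_mul_swapMat_swap M G]
  rw [← frobSq_submatrix_swap M]
  exact integral_norm_trace_mul_swapLeft_sq_le _ G

omit [Fintype β] [Fintype κ] in
theorem hasMatrixDerivAt_swapMat (x y : (α × β → κ → ℂ) × (α × β → κ → ℂ)) :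
    HasMatrixDerivAt (fun t : ℝ => swapMat (x + t • y).1 (x + t • y).2)
      (swapMat y.1 x.2 + swapMat x.1 y.2) 0 := by
  intro u w
  have h : ∀ z z' : ℂ, HasDerivAt (fun t : ℝ => z + t • z') z' 0 := fun z z' => by
    simpa using ((hasDerivAt_id (0 : ℝ)).smul_const z').const_add z
  simp only [swapMat_apply, Matrix.add_apply, ← Finset.sum_add_distrib]
  refine HasDerivAt.fun_sum fun j _ => ?_
  simpa using (h (x.1 (j, u.1) w.1) (y.1 (j, u.1) w.1)).fun_mul
    (h (x.2 (j, u.2) w.2) (y.2 (j, u.2) w.2))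

variable [DecidableEq β]

/-- The trace of a power of the shifted Gram matrix, as a function of the two arrays. -/
def momentFn (a b : ℝ) (p : ℕ) (v : (α × β → κ → ℂ) × (α × β → κ → ℂ)) : ℂ :=
  (shiftedGram a b (swapMat v.1 v.2) ^ p).trace

/-- The matrix representing the gradient of `momentFn`. -/
def gradMat (a b : ℝ) (q : ℕ) (v : (α × β → κ → ℂ) × (α × β → κ → ℂ)) :
    Matrix (κ × κ) (β × β) ℂ :=
  (swapMat v.1 v.2)ᴴ * shiftedGram a b (swapMat v.1 v.2) ^ q

theorem temperate_shiftedGram (a b : ℝ) :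
    TemperateMatrix fun v : (α × β → κ → ℂ) × (α × β → κ → ℂ) =>
      shiftedGram a b (swapMat v.1 v.2) :=
  ((temperate_swapMat.mul temperate_swapMat.conjTranspose).const_smul _).sub (.const _)

theorem temperate_momentFn (a b : ℝ) (p : ℕ) :
    (momentFn (α := α) (β := β) (κ := κ) a b p).HasTemperateGrowth :=
  ((temperate_shiftedGram a b).pow p).trace

theorem temperate_gradMat (a b : ℝ) (q : ℕ) :
    TemperateMatrix (gradMat (α := α) (β := β) (κ := κ) a b q) :=
  temperate_swapMat.conjTranspose.mul ((temperate_shiftedGram a b).pow q)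

theorem norm_fderiv_momentFn_sq_le (a b : ℝ) (q : ℕ)
    (x y : (α × β → κ → ℂ) × (α × β → κ → ℂ)) :
    ‖fderiv ℝ (momentFn a b (q + 1)) x y‖ ^ 2 ≤ 8 * (q + 1) ^ 2 * a ^ 2 *
      (‖(gradMat a b q x * swapMat y.1 x.2).trace‖ ^ 2 +
        ‖(gradMat a b q x * swapMat x.1 y.2).trace‖ ^ 2) := by
  have hK := hasMatrixDerivAt_swapMat x y
  have hder := ((((hK.mul hK.conjTranspose).const_smul (a : ℂ)).sub_const
    ((b : ℂ) • (1 : Matrix (β × β) (β × β) ℂ))).pow (q + 1)).trace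
  have hfd := fderiv_apply_of_hasDerivAt_line (temperate_momentFn a b (q + 1)) hder
  rw [hfd]
  simp only [zero_smul, add_zero, Nat.add_sub_cancel]
  have h1 := norm_trace_deriv_le a b (swapMat x.1 x.2) (swapMat y.1 x.2 + swapMat x.1 y.2) q
  rw [Matrix.mul_add (_ * _), trace_add] at h1
  have h2 := h1.trans (mul_le_mul_of_nonneg_left (norm_add_le _ _) (by positivity))
  refine (pow_le_pow_left₀ (norm_nonneg _) h2 2).trans ?_
  have h3 : ∀ r s : ℝ, (2 * ((q : ℝ) + 1) * |a| * (r + s)) ^ 2 ≤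
      8 * ((q : ℝ) + 1) ^ 2 * a ^ 2 * (r ^ 2 + s ^ 2) := fun r s => by
    have : (r + s) ^ 2 ≤ 2 * (r ^ 2 + s ^ 2) := add_sq_le
    calc (2 * ((q : ℝ) + 1) * |a| * (r + s)) ^ 2 = 4 * ((q : ℝ) + 1) ^ 2 * a ^ 2 * (r + s) ^ 2 := by
          rw [mul_pow, mul_pow, mul_pow, sq_abs]
          ring
      _ ≤ 4 * ((q : ℝ) + 1) ^ 2 * a ^ 2 * (2 * (r ^ 2 + s ^ 2)) := by gcongr
      _ = _ := by ring
  exact h3 _ _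

theorem temperate_frobSq {E m n : Type*} [NormedAddCommGroup E] [NormedSpace ℝ E] [Fintype m]
    [Fintype n] {A : E → Matrix m n ℂ} (hA : TemperateMatrix A) :
    (fun x => frobSq (A x)).HasTemperateGrowth := by
  simp only [frobSq_eq_trace]
  exact Complex.reCLM.hasTemperateGrowth.comp (hA.mul hA.conjTranspose).trace

/-- Pairs of arrays. -/
abbrev ArrayPair (α β κ : Type*) : Type _ := (α × β → κ → ℂ) × (α × β → κ → ℂ)

instance borelSpace_arrayPair_prod : BorelSpace (ArrayPair α β κ × ArrayPair α β κ) :=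
  Prod.borelSpace

theorem isGaussian_prod_self {E : Type*} [NormedAddCommGroup E] [NormedSpace ℝ E]
    [MeasurableSpace E] [BorelSpace E] [SecondCountableTopology E] [CompleteSpace E]
    (η : Measure E) [IsGaussian η] : IsGaussian (η.prod η) := inferInstance

/-- The Dirichlet energy of the trace of a power of the shifted Gram matrix. -/
theorem integral_norm_fderiv_momentFn_sq_le (a b : ℝ) (q : ℕ) :
    ∫ v, ‖fderiv ℝ (momentFn (α := α) (β := β) (κ := κ) a b (q + 1)) v.1 v.2‖ ^ 2
      ∂(((ginibreArray (α × β) κ).prod (ginibreArray (α × β) κ)).prod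
        ((ginibreArray (α × β) κ).prod (ginibreArray (α × β) κ))) ≤
    8 * (q + 1) ^ 2 * a ^ 2 * ∫ x, (frobSq (Matrix.of x.1) + frobSq (Matrix.of x.2)) *
      frobSq (gradMat a b q x) ∂((ginibreArray (α × β) κ).prod (ginibreArray (α × β) κ)) := by
  set γ := ginibreArray (α × β) κ
  have hG := isGaussian_prod_self (γ.prod γ)
  have hM := temperate_gradMat (α := α) (β := β) (κ := κ) a b q
  have hM1 : TemperateMatrix fun v : ArrayPair α β κ × ArrayPair α β κ => gradMat a b q v.1 := hM.comp (.fst ℝ (ArrayPair α β κ) (ArrayPair α β κ))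
  have hS := temperate_swapMat (α := α) (β := β) (κ := κ)
  have hL : TemperateMatrix fun v : ArrayPair α β κ × ArrayPair α β κ => swapMat v.2.1 v.1.2 :=
    hS.comp (((ContinuousLinearMap.fst ℝ _ _).comp (.snd ℝ (ArrayPair α β κ) (ArrayPair α β κ))).prod
      ((ContinuousLinearMap.snd ℝ _ _).comp (.fst ℝ (ArrayPair α β κ) (ArrayPair α β κ))))
  have hR : TemperateMatrix fun v : ArrayPair α β κ × ArrayPair α β κ => swapMat v.1.1 v.2.2 :=
    hS.comp (((ContinuousLinearMap.fst ℝ _ _).comp (.fst ℝ (ArrayPair α β κ) (ArrayPair α β κ))).prod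
      ((ContinuousLinearMap.snd ℝ _ _).comp (.snd ℝ (ArrayPair α β κ) (ArrayPair α β κ))))
  have hLi : Integrable (fun v : ArrayPair α β κ × ArrayPair α β κ => ‖(gradMat a b q v.1 * swapMat v.2.1 v.1.2).trace‖ ^ 2)
      ((γ.prod γ).prod (γ.prod γ)) :=
    (memLp_two_of_temperate (hM1.mul hL).trace).integrable_norm_pow (by simp)
  have hRi : Integrable (fun v : ArrayPair α β κ × ArrayPair α β κ => ‖(gradMat a b q v.1 * swapMat v.1.1 v.2.2).trace‖ ^ 2)
      ((γ.prod γ).prod (γ.prod γ)) :=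
    (memLp_two_of_temperate (hM1.mul hR).trace).integrable_norm_pow (by simp)
  have ht1 : TemperateMatrix fun x : ArrayPair α β κ => Matrix.of x.1 := fun i j =>
    (temperate_entry i j).comp (ContinuousLinearMap.fst ℝ (α × β → κ → ℂ)
      (α × β → κ → ℂ)).hasTemperateGrowth
  have ht2 : TemperateMatrix fun x : ArrayPair α β κ => Matrix.of x.2 := fun i j =>
    (temperate_entry i j).comp (ContinuousLinearMap.snd ℝ (α × β → κ → ℂ)
      (α × β → κ → ℂ)).hasTemperateGrowth
  have hint : Integrable (fun x : ArrayPair α β κ => (frobSq (Matrix.of x.1) + frobSq (Matrix.of x.2)) *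
      frobSq (gradMat a b q x)) (γ.prod γ) :=
    integrable_of_temperate
      (((temperate_frobSq ht1).fun_add (temperate_frobSq ht2)).fun_mul (temperate_frobSq hM))
  calc _ ≤ ∫ v : ArrayPair α β κ × ArrayPair α β κ, 8 * (q + 1) ^ 2 * a ^ 2 *
        (‖(gradMat a b q v.1 * swapMat v.2.1 v.1.2).trace‖ ^ 2 +
          ‖(gradMat a b q v.1 * swapMat v.1.1 v.2.2).trace‖ ^ 2)
        ∂((γ.prod γ).prod (γ.prod γ)) :=
        integral_mono_of_nonneg (ae_of_all _ fun v => by positivity)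
          ((hLi.add hRi).const_mul _) (ae_of_all _ fun v => norm_fderiv_momentFn_sq_le a b q v.1 v.2)
    -- The increment `y` is integrated first; with the base point `x` frozen, each trace is linear
    -- in one array of `y`.
    _ = 8 * (q + 1) ^ 2 * a ^ 2 * ∫ x : ArrayPair α β κ,
        (∫ y : ArrayPair α β κ, (‖(gradMat a b q x * swapMat y.1 x.2).trace‖ ^ 2 +
          ‖(gradMat a b q x * swapMat x.1 y.2).trace‖ ^ 2) ∂(γ.prod γ)) ∂(γ.prod γ) := by
        rw [integral_const_mul]
        exact congrArg _ (integral_prod _ (hLi.add hRi))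
    _ ≤ _ := by
        gcongr 8 * (q + 1) ^ 2 * a ^ 2 * ?_
        refine integral_mono (hLi.add hRi).integral_prod_left hint fun x => ?_
        have hl : Integrable (fun G => ‖(gradMat a b q x * swapMat G x.2).trace‖ ^ 2) γ :=
          (memLp_two_of_temperate ((TemperateMatrix.const (gradMat a b q x)).mul
            (TemperateMatrix.linear (swapLeft x.2))).trace).integrable_norm_pow (by simp)
        have hr : Integrable (fun H => ‖(gradMat a b q x * swapMat x.1 H).trace‖ ^ 2) γ :=
          (memLp_two_of_temperate ((TemperateMatrix.const (gradMat a b q x)).mul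
            (TemperateMatrix.linear (swapRight x.1))).trace).integrable_norm_pow (by simp)
        simp only
        rw [integral_add (hl.comp_fst γ) (hr.comp_snd γ),
          integral_fun_fst (fun G => ‖(gradMat a b q x * swapMat G x.2).trace‖ ^ 2),
          integral_fun_snd (fun H => ‖(gradMat a b q x * swapMat x.1 H).trace‖ ^ 2),
          probReal_univ, one_smul, one_smul, add_mul, add_comm]
        exact add_le_add (integral_norm_trace_mul_swapRight_sq_le _ _)
          (integral_norm_trace_mul_swapLeft_sq_le _ _)

/-- Cauchy–Schwarz over the entries reduces this to fourth moments and keeps the right order, the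
square of the number of entries. -/
theorem integral_frobSq_sq_le {m n : Type*} [Fintype m] [Fintype n] :
    ∫ G, frobSq (Matrix.of G) ^ 2 ∂(ginibreArray m n) ≤
      ((Fintype.card m * Fintype.card n : ℕ) : ℝ) ^ 2 * gaussianFourthMoment := by
  have hi : ∀ p : m × n, Integrable (fun G : m → n → ℂ => ‖G p.1 p.2‖ ^ 4) (ginibreArray m n) :=
    fun p => by
      have : (fun G : m → n → ℂ => (G p.1 p.2) ^ 2).HasTemperateGrowth :=
        (temperate_entry p.1 p.2).fun_pow 2
      refine ((memLp_two_of_temperate this).integrable_norm_pow (by simp)).congr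
        (ae_of_all _ fun G => ?_)
      simp only [norm_pow]
      ring
  have hT : TemperateMatrix fun G : m → n → ℂ => Matrix.of G := fun i j => temperate_entry i j
  calc ∫ G, frobSq (Matrix.of G) ^ 2 ∂(ginibreArray m n)
      ≤ ∫ G, (Fintype.card (m × n) : ℝ) * ∑ p : m × n, ‖G p.1 p.2‖ ^ 4 ∂(ginibreArray m n) := by
        refine integral_mono (integrable_of_temperate ((temperate_frobSq hT).fun_pow 2))
          ((integrable_finsetSum _ fun p _ => hi p).const_mul _) fun G => ?_
        have := sq_sum_le_card_mul_sum_sq (s := (Finset.univ : Finset (m × n)))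
          (f := fun p => ‖G p.1 p.2‖ ^ 2)
        simp only [← pow_mul, Fintype.sum_prod_type, Finset.card_univ] at this
        simpa [frobSq, Fintype.sum_prod_type] using this
    _ = _ := by
        rw [integral_const_mul, integral_finsetSum _ fun p _ => hi p]
        simp only [integral_norm_entry_pow_four]
        simp [Fintype.card_prod]
        ring

end GradientBound

/-! ### Power counting in `d`. -/

section VarianceBound

open Matrix

/-- The law of a pair of independent Ginibre arrays. -/
abbrev ginibrePair (d s : ℕ) : Measure (ArrayPair (Fin d) (Fin d) (Fin s)) :=
  (ginibreArray (Fin d × Fin d) (Fin s)).prod (ginibreArray (Fin d × Fin d) (Fin s))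

theorem ginibrePair_mean (d s : ℕ) : (ginibrePair d s)[id] = 0 :=
  integral_id_prod ginibreArray_mean ginibreArray_mean

/-- The deterministic bound is used at spectral scale `t = d³`. Then `t²` gives `d⁶`, the dimension
gives `d²`, and the normalized moment gives another `d²`. -/
theorem integral_frobSq_gradMat_sq_le {d s : ℕ} (hd : 1 ≤ d) {a b c : ℝ} (hc : 1 ≤ c)
    (hs : (s : ℝ) ≤ c * d) (ha : |a| * (d : ℝ) ^ 3 ≤ c) (hb : |b| ≤ c) (q : ℕ) :
    ∫ v, frobSq (gradMat a b q v) ^ 2 ∂(ginibrePair d s) ≤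
      c ^ (4 * q) * 2 ^ (4 * q + 2) *
        (1 + 4 * khintchineConst (4 * q + 2) ^ 2 * c ^ (2 * (4 * q + 2))) * (d : ℝ) ^ 10 := by
  have hd0 : (0 : ℝ) < d := by exact_mod_cast hd
  have hM := temperate_gradMat (α := Fin d) (β := Fin d) (κ := Fin s) a b q
  have hS := temperate_swapMat (α := Fin d) (β := Fin d) (κ := Fin s)
  have hi := integrable_trace_re (γ := ginibrePair d s) ((hS.mul hS.conjTranspose).pow (4 * q + 2))
  have h1 := integral_trace_swapMat_pow_succ_le hc hs (4 * q + 1)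
  set T := ∫ v, ((swapMat v.1 v.2 * (swapMat v.1 v.2)ᴴ) ^ (4 * q + 2)).trace.re
    ∂(ginibrePair d s) with hT
  set A := khintchineConst (4 * q + 2)
  have h2 : (((d : ℝ) ^ 3)⁻¹) ^ (4 * q + 2) * T ≤ 4 * A ^ 2 * c ^ (2 * (4 * q + 2)) * d ^ 2 := by
    calc (((d : ℝ) ^ 3)⁻¹) ^ (4 * q + 2) * T ≤ (((d : ℝ) ^ 3)⁻¹) ^ (4 * q + 2) *
          (4 * A ^ 2 * c ^ (2 * (4 * q + 2)) * (d : ℝ) ^ (3 * (4 * q + 2) + 2)) := by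
          gcongr
      _ = 4 * A ^ 2 * c ^ (2 * (4 * q + 2)) * d ^ 2 *
          ((((d : ℝ) ^ 3)⁻¹) ^ (4 * q + 2) * ((d : ℝ) ^ 3) ^ (4 * q + 2)) := by
          rw [show (d : ℝ) ^ (3 * (4 * q + 2) + 2) = ((d : ℝ) ^ 3) ^ (4 * q + 2) * (d : ℝ) ^ 2 by
            rw [pow_add, pow_mul]]
          ring
      _ = _ := by
          rw [← mul_pow, inv_mul_cancel₀ (by positivity), one_pow, mul_one]
  calc ∫ v, frobSq (gradMat a b q v) ^ 2 ∂(ginibrePair d s)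
      ≤ ∫ v, ((d : ℝ) ^ 3) ^ 2 * c ^ (4 * q) * 2 ^ (4 * q + 2) * (d * d) *
          (d * d + (((d : ℝ) ^ 3)⁻¹) ^ (4 * q + 2) *
            ((swapMat v.1 v.2 * (swapMat v.1 v.2)ᴴ) ^ (4 * q + 2)).trace.re)
          ∂(ginibrePair d s) := by
        refine integral_mono (integrable_of_temperate ((temperate_frobSq hM).fun_pow 2))
          (((integrable_const _).add (hi.const_mul _)).const_mul _) fun v => ?_
        have := frobSq_conjTranspose_mul_shiftedGram_pow_le (zero_le_one.trans hc)
          (pow_pos hd0 3) ha hb (swapMat v.1 v.2) q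
        simp only [Fintype.card_prod, Fintype.card_fin, Nat.cast_mul] at this
        exact this
    _ = ((d : ℝ) ^ 3) ^ 2 * c ^ (4 * q) * 2 ^ (4 * q + 2) * (d * d) *
          (d * d + (((d : ℝ) ^ 3)⁻¹) ^ (4 * q + 2) * T) := by
        rw [integral_const_mul, integral_add (integrable_const _) (hi.const_mul _),
          integral_const, probReal_univ, one_smul, integral_const_mul]
    _ ≤ ((d : ℝ) ^ 3) ^ 2 * c ^ (4 * q) * 2 ^ (4 * q + 2) * (d * d) *
          (d * d + 4 * A ^ 2 * c ^ (2 * (4 * q + 2)) * d ^ 2) := by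
        gcongr
    _ = _ := by ring

theorem integral_frobSq_mul_frobSq_le {d s : ℕ} (hd : 1 ≤ d) {c C : ℝ} (hs : (s : ℝ) ≤ c * d)
    {M : ArrayPair (Fin d) (Fin d) (Fin s) → Matrix (Fin s × Fin s) (Fin d × Fin d) ℂ}
    (hM : TemperateMatrix M)
    (hC : ∫ v, frobSq (M v) ^ 2 ∂(ginibrePair d s) ≤ C * (d : ℝ) ^ 10) :
    ∫ v, (frobSq (Matrix.of v.1) + frobSq (Matrix.of v.2)) * frobSq (M v) ∂(ginibrePair d s) ≤
      (c ^ 2 * gaussianFourthMoment + C) * (d : ℝ) ^ 8 := by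
  have hd0 : (0 : ℝ) < d := by exact_mod_cast hd
  have hg : 0 ≤ gaussianFourthMoment := integral_nonneg fun _ => by positivity
  have ht1 : TemperateMatrix fun v : ArrayPair (Fin d) (Fin d) (Fin s) => Matrix.of v.1 :=
    fun i j => (temperate_entry i j).comp (ContinuousLinearMap.fst ℝ
      (Fin d × Fin d → Fin s → ℂ) (Fin d × Fin d → Fin s → ℂ)).hasTemperateGrowth
  have ht2 : TemperateMatrix fun v : ArrayPair (Fin d) (Fin d) (Fin s) => Matrix.of v.2 :=
    fun i j => (temperate_entry i j).comp (ContinuousLinearMap.snd ℝ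
      (Fin d × Fin d → Fin s → ℂ) (Fin d × Fin d → Fin s → ℂ)).hasTemperateGrowth
  have hf1 := temperate_frobSq ht1
  have hf2 := temperate_frobSq ht2
  have hf := temperate_frobSq hM
  have hi1 := integrable_of_temperate (γ := ginibrePair d s) (hf1.fun_pow 2)
  have hi2 := integrable_of_temperate (γ := ginibrePair d s) (hf2.fun_pow 2)
  have hi := integrable_of_temperate (γ := ginibrePair d s) (hf.fun_pow 2)
  have hi12 : Integrable (fun v : ArrayPair (Fin d) (Fin d) (Fin s) =>
      frobSq (Matrix.of v.1) ^ 2 + frobSq (Matrix.of v.2) ^ 2) (ginibrePair d s) := hi1.add hi2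
  have hm : ∫ G, frobSq (Matrix.of G) ^ 2 ∂(ginibreArray (Fin d × Fin d) (Fin s)) ≤
      c ^ 2 * (d : ℝ) ^ 6 * gaussianFourthMoment := by
    refine integral_frobSq_sq_le.trans ?_
    simp only [Fintype.card_prod, Fintype.card_fin]
    push_cast
    gcongr
    calc ((d : ℝ) * d * s) ^ 2 ≤ ((d : ℝ) * d * (c * d)) ^ 2 := by gcongr
      _ = _ := by ring
  have e1 : ∫ v, frobSq (Matrix.of v.1) ^ 2 ∂(ginibrePair d s) ≤
      c ^ 2 * (d : ℝ) ^ 6 * gaussianFourthMoment := by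
    rw [integral_fun_fst (fun G : Fin d × Fin d → Fin s → ℂ => frobSq (Matrix.of G) ^ 2),
      probReal_univ, one_smul]
    exact hm
  have e2 : ∫ v, frobSq (Matrix.of v.2) ^ 2 ∂(ginibrePair d s) ≤
      c ^ 2 * (d : ℝ) ^ 6 * gaussianFourthMoment := by
    rw [integral_fun_snd (fun G : Fin d × Fin d → Fin s → ℂ => frobSq (Matrix.of G) ^ 2),
      probReal_univ, one_smul]
    exact hm
  calc _ ≤ ∫ v, ((d : ℝ) ^ 2 / 2 * (frobSq (Matrix.of v.1) ^ 2 + frobSq (Matrix.of v.2) ^ 2) +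
        ((d : ℝ) ^ 2)⁻¹ * frobSq (M v) ^ 2) ∂(ginibrePair d s) := by
        refine integral_mono (integrable_of_temperate ((hf1.fun_add hf2).fun_mul hf))
          ((hi12.const_mul _).add (hi.const_mul _)) fun v => ?_
        -- The weight `d²` balances the second moments: `d² · d⁶` for the arrays against `d⁻² · d¹⁰`
        -- for the gradient.
        have key : ∀ x y z : ℝ, (x + y) * z ≤
            (d : ℝ) ^ 2 / 2 * (x ^ 2 + y ^ 2) + ((d : ℝ) ^ 2)⁻¹ * z ^ 2 := fun x y z => by
          have hz : z = d * (z / d) := by field_simp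
          have hz2 : ((d : ℝ) ^ 2)⁻¹ * z ^ 2 = (z / d) ^ 2 := by field_simp
          rw [hz2]
          set w := z / d
          rw [hz]
          nlinarith [sq_nonneg (d * x - w), sq_nonneg (d * y - w)]
        exact key _ _ _
    _ = (d : ℝ) ^ 2 / 2 * ((∫ v, frobSq (Matrix.of v.1) ^ 2 ∂(ginibrePair d s)) +
        ∫ v, frobSq (Matrix.of v.2) ^ 2 ∂(ginibrePair d s)) +
        ((d : ℝ) ^ 2)⁻¹ * ∫ v, frobSq (M v) ^ 2 ∂(ginibrePair d s) := by
        rw [integral_add (hi12.const_mul _) (hi.const_mul _), integral_const_mul,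
          integral_const_mul, integral_add hi1 hi2]
    _ ≤ (d : ℝ) ^ 2 / 2 * (c ^ 2 * (d : ℝ) ^ 6 * gaussianFourthMoment +
          c ^ 2 * (d : ℝ) ^ 6 * gaussianFourthMoment) + ((d : ℝ) ^ 2)⁻¹ * (C * (d : ℝ) ^ 10) := by
        gcongr
    _ = _ := by
        field_simp
        ring

/-- The variance of the normalized trace of a power of the rescaled matrix. -/
theorem exists_variance_bound {c : ℝ} (hc : 1 ≤ c) (p : ℕ) :
    ∃ C : ℝ, ∀ d s : ℕ, 1 ≤ d → (s : ℝ) ≤ c * d → (d : ℝ) ≤ c * s →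
      ∫ v, ‖momentFn (α := Fin d) (β := Fin d) (κ := Fin s)
        ((d * s) * (1 / (d ^ 2 * s ^ 2)) * (1 / d)) ((d * s) * (1 / d ^ 2)) p v -
        ∫ v', momentFn ((d * s) * (1 / (d ^ 2 * s ^ 2)) * (1 / d)) ((d * s) * (1 / d ^ 2)) p v'
          ∂(ginibrePair d s)‖ ^ 2 ∂(ginibrePair d s) ≤ C * (d : ℝ) ^ 2 := by
  rcases p with _ | q
  · refine ⟨0, fun d s _ _ _ => ?_⟩
    simp [momentFn]
  set C₁ : ℝ := c ^ (4 * q) * 2 ^ (4 * q + 2) *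
    (1 + 4 * khintchineConst (4 * q + 2) ^ 2 * c ^ (2 * (4 * q + 2))) with hC₁
  have hg : 0 ≤ gaussianFourthMoment := integral_nonneg fun _ => by positivity
  have hC₁0 : 0 ≤ C₁ := by positivity
  -- 16 is the Poincaré constant 2 times the gradient constant 8, and `c²` bounds `a² d⁶`. The
  -- energy bound `d⁸` then leaves `d²`.
  refine ⟨16 * (q + 1) ^ 2 * c ^ 2 * (c ^ 2 * gaussianFourthMoment + C₁), fun d s hd hs hs' => ?_⟩
  have hd0 : (0 : ℝ) < d := by exact_mod_cast hd
  have hs0 : (0 : ℝ) < s := by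
    by_contra h
    have : (s : ℝ) = 0 := le_antisymm (not_lt.1 h) (Nat.cast_nonneg s)
    rw [this, mul_zero] at hs'
    linarith
  set a : ℝ := (d * s) * (1 / (d ^ 2 * s ^ 2)) * (1 / d) with ha
  set b : ℝ := (d * s) * (1 / d ^ 2) with hb
  have ha0 : 0 ≤ a := by positivity
  have ha3 : |a| * (d : ℝ) ^ 3 ≤ c := by
    rw [abs_of_nonneg ha0]
    have : a * (d : ℝ) ^ 3 = d / s := by
      rw [ha]
      field_simp
    rw [this, div_le_iff₀ hs0]
    exact hs'
  have hbc : |b| ≤ c := by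
    have : b = s / d := by
      rw [hb]
      field_simp
    rw [this, abs_of_nonneg (by positivity), div_le_iff₀ hd0]
    exact hs
  have h1 := integral_sq_sub_mean_le (ginibrePair_mean d s)
    (temperate_momentFn (α := Fin d) (β := Fin d) (κ := Fin s) a b (q + 1))
  have h2 := integral_norm_fderiv_momentFn_sq_le (α := Fin d) (β := Fin d) (κ := Fin s) a b q
  have h3 := integral_frobSq_mul_frobSq_le hd hs (temperate_gradMat a b q)
    (integral_frobSq_gradMat_sq_le hd hc hs ha3 hbc q)
  have ha6 : a ^ 2 * (d : ℝ) ^ 6 ≤ c ^ 2 := by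
    rw [abs_of_nonneg ha0] at ha3
    calc a ^ 2 * (d : ℝ) ^ 6 = (a * (d : ℝ) ^ 3) ^ 2 := by ring
      _ ≤ c ^ 2 := by gcongr
  calc _ ≤ _ := h1
    _ ≤ 2 * (8 * (q + 1) ^ 2 * a ^ 2 * ((c ^ 2 * gaussianFourthMoment + C₁) * (d : ℝ) ^ 8)) := by
        gcongr
        refine h2.trans ?_
        gcongr
    _ = 16 * (q + 1) ^ 2 * (a ^ 2 * (d : ℝ) ^ 6) * (c ^ 2 * gaussianFourthMoment + C₁) *
        (d : ℝ) ^ 2 := by ring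
    _ ≤ _ := by gcongr

end VarianceBound

/-! ### From Gaussian arrays to Wishart pairs, and almost sure convergence. -/

section Transfer

open Matrix

instance borelSpace_matrix {m n : Type*} [Countable m] [Countable n] :
    BorelSpace (Matrix m n ℂ) :=
  inferInstanceAs (BorelSpace (m → n → ℂ))

instance secondCountableTopology_matrix {m n : Type*} [Countable m] [Countable n] :
    SecondCountableTopology (Matrix m n ℂ) :=
  inferInstanceAs (SecondCountableTopology (m → n → ℂ))

/-- The pair of Gram matrices of a pair of arrays. -/
def gramPair {d s : ℕ} (v : ArrayPair (Fin d) (Fin d) (Fin s)) :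
    Matrix (Fin d × Fin d) (Fin d × Fin d) ℂ × Matrix (Fin d × Fin d) (Fin d × Fin d) ℂ :=
  (Matrix.of v.1 * (Matrix.of v.1)ᴴ, Matrix.of v.2 * (Matrix.of v.2)ᴴ)

theorem measurable_gram {d s : ℕ} :
    Measurable fun G : Fin d × Fin d → Fin s → ℂ => Matrix.of G * (Matrix.of G)ᴴ := by
  have h : Continuous fun G : Fin d × Fin d → Fin s → ℂ => Matrix.of G := continuous_id
  exact (h.matrix_mul h.matrix_conjTranspose).measurable

theorem measurable_gramPair {d s : ℕ} : Measurable (gramPair (d := d) (s := s)) :=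
  (measurable_gram.comp measurable_fst).prodMk (measurable_gram.comp measurable_snd)

theorem wishart_prod_wishart (d s : ℕ) :
    (wishart (Fin d × Fin d) s).prod (wishart (Fin d × Fin d) s) =
      (ginibrePair d s).map gramPair := by
  have h : wishart (Fin d × Fin d) s = (ginibreArray (Fin d × Fin d) (Fin s)).map
      fun G => Matrix.of G * (Matrix.of G)ᴴ := rfl
  rw [h, Measure.map_prod_map _ _ measurable_gram measurable_gram]
  rfl

theorem continuous_normMoment {d : ℕ} (s p : ℕ) :
    Continuous fun w : Matrix (Fin d × Fin d) (Fin d × Fin d) ℂ ×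
      Matrix (Fin d × Fin d) (Fin d × Fin d) ℂ => normMoment s p w.1 w.2 := by
  have h : Continuous fun w : Matrix (Fin d × Fin d) (Fin d × Fin d) ℂ ×
      Matrix (Fin d × Fin d) (Fin d × Fin d) ℂ => swapping w.1 w.2 := by
    refine continuous_matrix fun u u' => ?_
    simp only [swapping_apply]
    refine continuous_const.mul (continuous_finsetSum _ fun j _ => continuous_finsetSum _ fun l _ =>
      (continuous_fst.matrix_elem _ _).mul (continuous_snd.matrix_elem _ _))
  have h' : Continuous fun w : Matrix (Fin d × Fin d) (Fin d × Fin d) ℂ ×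
      Matrix (Fin d × Fin d) (Fin d × Fin d) ℂ => rescaled s w.1 w.2 :=
    ((h.fun_const_smul _).sub continuous_const).fun_const_smul _
  exact continuous_const.mul (h'.pow p).matrix_trace

theorem normMoment_gramPair {d s : ℕ} (p : ℕ) (v : ArrayPair (Fin d) (Fin d) (Fin s)) :
    normMoment s p (gramPair v).1 (gramPair v).2 = (1 / (d : ℂ) ^ 2) *
      momentFn ((d * s) * (1 / (d ^ 2 * s ^ 2)) * (1 / d)) ((d * s) * (1 / d ^ 2)) p v := by
  rw [normMoment, gramPair, rescaled_gram, momentFn]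

variable {Ω : Type*} [MeasurableSpace Ω] {P : Measure Ω}

theorem hasLaw_pair [IsFiniteMeasure P] {d s : ℕ} {W₁ W₂ : Ω → Matrix (Fin d × Fin d) (Fin d × Fin d) ℂ}
    (hW₁ : HasLaw W₁ (wishart (Fin d × Fin d) s) P) (hW₂ : HasLaw W₂ (wishart (Fin d × Fin d) s) P)
    (hW : IndepFun W₁ W₂ P) :
    HasLaw (fun ω => (W₁ ω, W₂ ω)) ((ginibrePair d s).map gramPair) P := by
  refine ⟨hW₁.aemeasurable.prodMk hW₂.aemeasurable, ?_⟩
  rw [(indepFun_iff_map_prod_eq_prod_map_map hW₁.aemeasurable hW₂.aemeasurable).1 hW, hW₁.map_eq,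
    hW₂.map_eq, wishart_prod_wishart]

theorem integral_comp_pair {F : Type*} [NormedAddCommGroup F] [NormedSpace ℝ F] {d s : ℕ}
    {W₁ W₂ : Ω → Matrix (Fin d × Fin d) (Fin d × Fin d) ℂ}
    (hlaw : HasLaw (fun ω => (W₁ ω, W₂ ω)) ((ginibrePair d s).map gramPair) P)
    {φ : Matrix (Fin d × Fin d) (Fin d × Fin d) ℂ × Matrix (Fin d × Fin d) (Fin d × Fin d) ℂ → F}
    (hφ : Continuous φ) : ∫ ω, φ (W₁ ω, W₂ ω) ∂P = ∫ v, φ (gramPair v) ∂(ginibrePair d s) := by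
  have h := hlaw.integral_comp (f := φ) hφ.aestronglyMeasurable
  refine h.trans ?_
  rw [integral_map measurable_gramPair.aemeasurable
    hφ.aestronglyMeasurable]

theorem memLp_normMoment {d s : ℕ}
    {W₁ W₂ : Ω → Matrix (Fin d × Fin d) (Fin d × Fin d) ℂ}
    (hlaw : HasLaw (fun ω => (W₁ ω, W₂ ω)) ((ginibrePair d s).map gramPair) P) (p : ℕ) :
    MemLp (fun ω => normMoment s p (W₁ ω) (W₂ ω)) 2 P := by
  have hφ := continuous_normMoment (d := d) s p
  have h1 : MemLp (fun v => normMoment s p (gramPair v).1 (gramPair v).2) 2 (ginibrePair d s) := by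
    simp only [normMoment_gramPair]
    exact (memLp_two_of_temperate (temperate_momentFn _ _ p)).const_mul _
  have h2 := (memLp_map_measure_iff (f := gramPair) hφ.aestronglyMeasurable
    measurable_gramPair.aemeasurable).2 h1
  rw [← hlaw.map_eq] at h2
  exact (memLp_map_measure_iff hφ.aestronglyMeasurable hlaw.aemeasurable).1 h2

/-- A sequence of random variables with summable second moments tends to zero almost surely. -/
theorem ae_tendsto_zero_of_summable_sq {X : ℕ → Ω → ℂ} (hX : ∀ d, MemLp (X d) 2 P)
    (hs : Summable fun d => ∫ ω, ‖X d ω‖ ^ 2 ∂P) :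
    ∀ᵐ ω ∂P, Tendsto (fun d => X d ω) atTop (𝓝 0) := by
  have hi : ∀ d, Integrable (fun ω => ‖X d ω‖ ^ 2) P := fun d =>
    (hX d).integrable_norm_pow (by simp)
  have hl : ∀ d, ∫⁻ ω, ENNReal.ofReal (‖X d ω‖ ^ 2) ∂P = ENNReal.ofReal (∫ ω, ‖X d ω‖ ^ 2 ∂P) :=
    fun d => (ofReal_integral_eq_lintegral_ofReal (hi d) (ae_of_all _ fun ω => by positivity)).symm
  have hm : ∀ d, AEMeasurable (fun ω => ENNReal.ofReal (‖X d ω‖ ^ 2)) P := fun d =>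
    (hi d).aestronglyMeasurable.aemeasurable.ennreal_ofReal
  have hfin : ∫⁻ ω, ∑' d, ENNReal.ofReal (‖X d ω‖ ^ 2) ∂P ≠ ⊤ := by
    rw [lintegral_tsum hm]
    simp only [hl]
    exact hs.tsum_ofReal_ne_top
  -- The sum of the squares has finite expectation, so it is finite almost surely and its terms tend
  -- to zero.
  filter_upwards [ae_lt_top' (AEMeasurable.tsum hm) hfin] with ω hω
  have h := ENNReal.tendsto_atTop_zero_of_tsum_ne_top hω.ne
  have h' : Tendsto (fun d => ‖X d ω‖ ^ 2) atTop (𝓝 0) := by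
    have := (ENNReal.tendsto_toReal ENNReal.zero_ne_top).comp h
    simpa [Function.comp_def, ENNReal.toReal_ofReal] using this
  rw [tendsto_zero_iff_norm_tendsto_zero]
  have := (Real.continuous_sqrt.tendsto 0).comp h'
  simpa [Function.comp_def, Real.sqrt_sq] using this

end Transfer

end WishartSwap

end

theorem theorem3p4 {Ω : Type*} [MeasurableSpace Ω] (P : Measure Ω) [IsProbabilityMeasure P]
    (c : ℝ) (hc : 0 < c) (s : ℕ → ℕ)
    (hs : Tendsto (fun d : ℕ => (s d : ℝ) / (d : ℝ)) atTop (𝓝 c))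
    (W₁ W₂ : (d : ℕ) → Ω → Matrix (Fin d × Fin d) (Fin d × Fin d) ℂ)
    (hW₁ : ∀ d, HasLaw (W₁ d) (WishartSwap.wishart (Fin d × Fin d) (s d)) P)
    (hW₂ : ∀ d, HasLaw (W₂ d) (WishartSwap.wishart (Fin d × Fin d) (s d)) P)
    (hW : ∀ d, IndepFun (W₁ d) (W₂ d) P) (p : ℕ) :
    (∀ d, MemLp (fun ω => WishartSwap.normMoment (s d) p (W₁ d ω) (W₂ d ω)) 2 P) ∧
    (fun d : ℕ => ∫ ω, ‖WishartSwap.normMoment (s d) p (W₁ d ω) (W₂ d ω) -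
        ∫ ω', WishartSwap.normMoment (s d) p (W₁ d ω') (W₂ d ω') ∂P‖ ^ 2 ∂P)
      =O[atTop] (fun d : ℕ => 1 / (d : ℝ) ^ 2) ∧
    ∀ᵐ ω ∂P, Tendsto (fun d : ℕ => WishartSwap.normMoment (s d) p (W₁ d ω) (W₂ d ω) -
        ∫ ω', WishartSwap.normMoment (s d) p (W₁ d ω') (W₂ d ω') ∂P) atTop (𝓝 0) := by
  have hlaw := fun d => WishartSwap.hasLaw_pair (hW₁ d) (hW₂ d) (hW d)
  have hmem : ∀ d, MemLp (fun ω => WishartSwap.normMoment (s d) p (W₁ d ω) (W₂ d ω)) 2 P :=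
    fun d => WishartSwap.memLp_normMoment (hlaw d) p
  -- Since `s/d` eventually lies between `c/2` and `2c`, this constant gives both `s ≤ b d` and `d ≤
  -- b s`.
  set b : ℝ := max 1 (max (2 * c) (2 / c)) with hb
  have hb1 : 1 ≤ b := le_max_left _ _
  obtain ⟨C, hC⟩ := WishartSwap.exists_variance_bound hb1 p
  have hvar : ∀ᶠ d : ℕ in atTop, ∫ ω, ‖WishartSwap.normMoment (s d) p (W₁ d ω) (W₂ d ω) -
      ∫ ω', WishartSwap.normMoment (s d) p (W₁ d ω') (W₂ d ω') ∂P‖ ^ 2 ∂P ≤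
      C * (1 / (d : ℝ) ^ 2) := by
    filter_upwards [hs.eventually_lt_const (show c < 2 * c by linarith),
      hs.eventually_const_lt (show c / 2 < c by linarith), eventually_ge_atTop 1] with d h1 h2 hd
    have hd0 : (0 : ℝ) < d := by exact_mod_cast hd
    rw [div_lt_iff₀ hd0] at h1
    rw [lt_div_iff₀ hd0] at h2
    have hs1 : (s d : ℝ) ≤ b * d := h1.le.trans (by
      gcongr
      exact (le_max_left _ _).trans (le_max_right _ _))
    have hs2 : (d : ℝ) ≤ b * s d := by
      calc (d : ℝ) = 2 / c * (c / 2 * d) := by field_simp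
        _ ≤ b * s d := by
          gcongr
          exact (le_max_right _ _).trans (le_max_right _ _)
    have hφ := WishartSwap.continuous_normMoment (d := d) (s d) p
    rw [WishartSwap.integral_comp_pair (hlaw d) hφ, WishartSwap.integral_comp_pair (hlaw d)
      (φ := fun w => ‖WishartSwap.normMoment (s d) p w.1 w.2 - ∫ v, WishartSwap.normMoment (s d) p
        (WishartSwap.gramPair v).1 (WishartSwap.gramPair v).2
          ∂(WishartSwap.ginibrePair d (s d))‖ ^ 2) ((hφ.sub continuous_const).norm.pow 2)]
    simp only [WishartSwap.normMoment_gramPair]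
    rw [integral_const_mul]
    simp only [← mul_sub, norm_mul, mul_pow]
    rw [integral_const_mul]
    have := hC d (s d) hd hs1 hs2
    -- The normalization contributes `d⁻⁴` against the variance bound `C d²` of the plain trace.
    calc _ ≤ ‖1 / (d : ℂ) ^ 2‖ ^ 2 * (C * (d : ℝ) ^ 2) := by gcongr
      _ = _ := by
        simp only [norm_div, norm_one, norm_pow, Complex.norm_natCast]
        field_simp
  have hbig : (fun d : ℕ => ∫ ω, ‖WishartSwap.normMoment (s d) p (W₁ d ω) (W₂ d ω) -
        ∫ ω', WishartSwap.normMoment (s d) p (W₁ d ω') (W₂ d ω') ∂P‖ ^ 2 ∂P)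
      =O[atTop] (fun d : ℕ => 1 / (d : ℝ) ^ 2) := by
    refine IsBigO.of_bound C ?_
    filter_upwards [hvar] with d hd
    rwa [Real.norm_of_nonneg (integral_nonneg fun _ => by positivity),
      Real.norm_of_nonneg (by positivity)]
  refine ⟨hmem, hbig, ?_⟩
  exact WishartSwap.ae_tendsto_zero_of_summable_sq
    (fun d => (hmem d).sub (memLp_const _))
    (summable_of_isBigO_nat (Real.summable_one_div_nat_pow.2 one_lt_two) hbig)
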